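/- Let $\{Z_t\}_{t\ge 0}$, $Z_0=1$, be a (right-continuous) continuous-time Markov branching process in which particles live independent exponential times with parameter $1$ and are then replaced by $k$ new particles with probability $p_k$, $k\ge0$, all independently. Let $f(s)=\sum_{k\ge0}p_ks^k$, and assume $f(1)=1$ and $m_1=f'(1)\in(1,\infty)$. Let $q\in[0,1)$ be the smallest non-negative root of $f(x)=x$, put $\gamma=\dfrac{1-f'(q)}{m_1-1}$, and for $n\ge1$ let $$f^{(n)}(s_1,\dots,s_n)=\sum_{i_1,\dots,i_n\ge0}p_{i_1+\dots+i_n+n-1}\,s_1^{i_1}\cdots s_n^{i_n}$$ be the $n$-th order tail generating function of $f$, and $$\psi_{q,1}(x)=\frac{f^{(4)}(q,q,1,x)-\gamma f^{(4)}(q,1,1,x)}{f^{(3)}(q,1,x)},\qquad 0\le x<1 .$$ Then $Z_te^{-(m_1-1)t}$ converges almost surely as $t\to\infty$ to a finite limit $W$. Let $\eta(\rho)=\mathrm{E}\,e^{-\rho W}$ for $\rho\ge0$. If $$\sum_{k=2}^\infty p_k\,k\ln k<\infty,$$ then for every $\rho>0$ the function $\psi_{q,1}$ is integrable over $(\eta(\rho),1)$,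 $$\eta(\rho)=q+(1-q)\Big(\frac{1-\eta(\rho)}{\rho}\Big)^{\gamma}\exp\Big\{-\int_{\eta(\rho)}^1\psi_{q,1}(x)\,dx\Big\},$$ and $\eta(\rho)\in(q,1)$. If $\sum_{k=2}^\infty p_k\,k\ln k=\infty$, then $\eta(\rho)=1$ for all $\rho\ge0$, and $\mathrm{P}(W=0)=1$. -/

import Mathlib

open MeasureTheory Filter Topology Asymptotics
open scoped NNReal

noncomputable section

namespace MarkovBranching

/-- The generating function `f(s) = ∑ p_k s^k` of the reproduction law. -/
def pgf (p : ℕ → ℝ) (s : ℝ) : ℝ := ∑' k : ℕ, p k * s ^ k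

/-- The derivative `f'(s) = ∑ k p_k s^(k-1)`, as a power series; `f'(1)` is the mean `m₁`. -/
def pgfDeriv (p : ℕ → ℝ) (s : ℝ) : ℝ := ∑' k : ℕ, (k : ℝ) * p k * s ^ (k - 1)

/-- The mean offspring number `m₁ = ∑ k p_k`. -/
def mean (p : ℕ → ℝ) : ℝ := ∑' k : ℕ, (k : ℝ) * p k

/-- The smallest non-negative root `q` of `f(x) = x` (the probability of ultimate extinction). -/
def extinctionRoot (p : ℕ → ℝ) : ℝ := sInf {x : ℝ | 0 ≤ x ∧ pgf p x = x}

/-- The `n`-th order tail generating function (`n ≥ 1`) of the power series `∑ v_k s^k`: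
`v⁽ⁿ⁾(s₁,…,sₙ) = ∑_{i₁,…,iₙ ≥ 0} v_{i₁+…+iₙ+n-1} s₁^{i₁} ⋯ sₙ^{iₙ}`. -/
def tailGF (v : ℕ → ℝ) {n : ℕ} (s : Fin n → ℝ) : ℝ :=
  ∑' i : Fin n → ℕ, v ((∑ k, i k) + (n - 1)) * ∏ k, s k ^ i k

/-- `γ = α / β` with `α = 1 - f'(q)` and `β = f'(r) - 1`. -/
def gam (p : ℕ → ℝ) (q r : ℝ) : ℝ := (1 - pgfDeriv p q) / (pgfDeriv p r - 1)

/-- `ψ_{q,r}(x) = (f⁽⁴⁾(q,q,r,x) - γ f⁽⁴⁾(q,r,r,x)) / f⁽³⁾(q,r,x)`. -/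
def psi (p : ℕ → ℝ) (q r x : ℝ) : ℝ :=
  (tailGF p ![q, q, r, x] - gam p q r * tailGF p ![q, r, r, x]) / tailGF p ![q, r, x]

/-- `P t i j` is the transition function (on the non-negative integers) of the regular Markov
branching process in which each particle lives an exponential time with parameter `1` and is then
replaced by `k` particles with probability `p k`, all particles behaving independently: a stochastic
semigroup with the branching property (started from `i` particles, the population is the sum
of `i` independent copies of the population started from one particle) and
with the infinitesimal probabilities `P h 1 j = 1_{j = 1} + (p j - 1_{j = 1}) h + o(h)`. -/
structure IsBranchingSemigroup (p : ℕ → ℝ) (P : ℝ≥0 → ℕ → ℕ → ℝ) : Prop where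
  nonneg : ∀ t i j, 0 ≤ P t i j
  hasSum_one : ∀ t i, HasSum (fun j => P t i j) 1
  zero : ∀ i j, P 0 i j = if i = j then 1 else 0
  chapman_kolmogorov : ∀ s t i j, HasSum (fun k => P s i k * P t k j) (P (s + t) i j)
  branching : ∀ t i, ∀ s ∈ Set.Icc (0 : ℝ) 1,
    ∑' j : ℕ, P t i j * s ^ j = (∑' j : ℕ, P t 1 j * s ^ j) ^ i
  infinitesimal : ∀ j,
    (fun h : ℝ≥0 => P h 1 j - ((if j = 1 then 1 else 0)
      + (p j - if j = 1 then 1 else 0) * (h : ℝ))) =o[𝓝 0] (fun h : ℝ≥0 => (h : ℝ))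

/-- `Z` is a (regular) continuous time Markov branching process with reproduction law `p`,
splitting rate `1` and `Z_0 = 1`: a right-continuous process with values in the
non-negative integers that is a time homogeneous Markov process, with respect to the
σ-algebras `σ(Z_u : u ≤ s)`, whose transition function is that of the branching mechanism `p`. -/
structure IsBranchingProcess {Ω : Type*} [MeasurableSpace Ω] (p : ℕ → ℝ)
    (Z : ℝ≥0 → Ω → ℕ) (μ : Measure Ω) : Prop where
  measurable : ∀ t, Measurable (Z t)
  start : ∀ᵐ ω ∂μ, Z 0 ω = 1
  rightContinuous : ∀ᵐ ω ∂μ, ∀ t : ℝ≥0, ContinuousWithinAt (fun u => Z u ω) (Set.Ici t) t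
  markov : ∃ P : ℝ≥0 → ℕ → ℕ → ℝ, IsBranchingSemigroup p P ∧
    ∀ (s t : ℝ≥0) (i j : ℕ) (A : Set Ω),
      MeasurableSet[⨆ u : Set.Iic s, MeasurableSpace.comap (Z u) ⊤] A →
      μ.real (A ∩ {ω | Z s ω = i} ∩ {ω | Z (s + t) ω = j})
        = μ.real (A ∩ {ω | Z s ω = i}) * P t i j

/-- The Laplace transform `η(ρ) = E e^{-ρ W}`. -/
def laplace {Ω : Type*} [MeasurableSpace Ω] (μ : Measure Ω) (W : Ω → ℝ) (ρ : ℝ) : ℝ :=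
  ∫ ω, Real.exp (-ρ * W ω) ∂μ

end MarkovBranching

end

/-! Write `F_t(x) = E x^{Z_t}` and `a = m₁ - 1`. The branching property gives `F_{s+t} = F_s ∘ F_t`,
and the infinitesimal description gives the backward equation `∂_t F_t = f(F_t) - F_t`. On `(q, 1)`,
where `x - f(x) > 0`, this equation is separable: a primitive of `-a / (x - f(x))` is `G(x) = log (1
- x) - ∫_y^x excess`, and `G(F_t(x)) - a t` does not depend on `t` (`log_one_sub_genFun`).

Now take `t = n` and `z_n = exp(-ρ e^{-a n})`. Then `F_n(z_n) = E exp(-ρ Z_n e^{-a n})` tends to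
`η(ρ)`, while `(1 - z_n) e^{a n}` tends to `ρ`. If `excess` is integrable near `1`, the limit of the
conserved relation is `1 - η = ρ exp(-∫_η^1 excess)`. If `η < 1`, the same relation bounds the
integrals of the nonnegative function `excess` up to `z_n → 1`, so it is integrable; without
integrability, `η = 1`.

Integrability of `excess` is the `k log k` condition: up to a factor bounded above and below,
`excess` is a power series with nonnegative coefficients whose integral over `(0, 1)` is `∑ p_k (k
H_k - k)` (`integrableOn_excess_iff`). The stated formula comes from the partial fraction identity
`ψ = 1 / (x - q) - γ excess` (`psi_eq`), because tail generating functions are divided differences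
of `f`.

Almost sure convergence is a supermartingale argument. Right continuity carries it from grids to
continuous time: an oscillating path would have unboundedly many upcrossings on fine grids
(`ae_not_oscillating`). -/

noncomputable section

open scoped ENNReal

namespace MarkovBranching

/-! ### The generating function of a supercritical law and its secant -/

/-- `p` is a probability distribution on `ℕ` with finite mean greater than one. -/
structure IsSupercritical (p : ℕ → ℝ) : Prop where
  nonneg : ∀ k, 0 ≤ p k
  hasSum_one : HasSum p 1
  summable_mean : Summable (fun k : ℕ => (k : ℝ) * p k)
  one_lt_mean : 1 < mean p

/-- The power series `∑ p_k (1 + x + ⋯ + x^(k-1))`, equal to `(1 - f(x)) / (1 - x)` for `x ≠ 1`. -/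
def secant (p : ℕ → ℝ) (x : ℝ) : ℝ := ∑' k : ℕ, p k * ∑ i ∈ Finset.range k, x ^ i

/-- The power series `∑ p_k ∑_{j < i < k} x^j`, equal to `(f'(1) - secant x) / (1 - x)`. -/
def deficit (p : ℕ → ℝ) (x : ℝ) : ℝ :=
  ∑' k : ℕ, p k * ∑ i ∈ Finset.range k, ∑ j ∈ Finset.range i, x ^ j

/-- The function `(f'(1) - 1) / (x - f(x)) - 1 / (1 - x)`. -/
def excess (p : ℕ → ℝ) (x : ℝ) : ℝ := (mean p - 1) / (x - pgf p x) - 1 / (1 - x)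

lemma sum_pow_le {x : ℝ} (hx : x ∈ Set.Icc (0 : ℝ) 1) (k : ℕ) :
    ∑ i ∈ Finset.range k, x ^ i ≤ k := by
  calc ∑ i ∈ Finset.range k, x ^ i ≤ ∑ i ∈ Finset.range k, (1 : ℝ) :=
        Finset.sum_le_sum fun i _ => pow_le_one₀ hx.1 hx.2
    _ = k := by simp

lemma sum_pow_nonneg {x : ℝ} (hx : x ∈ Set.Icc (0 : ℝ) 1) (k : ℕ) :
    0 ≤ ∑ i ∈ Finset.range k, x ^ i := Finset.sum_nonneg fun i _ => pow_nonneg hx.1 i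

lemma secant_one (p : ℕ → ℝ) : secant p 1 = mean p := by
  simp [secant, mean, mul_comm]

namespace IsSupercritical

variable {p : ℕ → ℝ} (hp : IsSupercritical p)
include hp

lemma summable_pgf {x : ℝ} (hx : x ∈ Set.Icc (0 : ℝ) 1) : Summable (fun k => p k * x ^ k) :=
  hp.hasSum_one.summable.of_nonneg_of_le (fun k => mul_nonneg (hp.nonneg k) (pow_nonneg hx.1 k))
    fun k => mul_le_of_le_one_right (hp.nonneg k) (pow_le_one₀ hx.1 hx.2)

lemma summable_secant {x : ℝ} (hx : x ∈ Set.Icc (0 : ℝ) 1) :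
    Summable (fun k => p k * ∑ i ∈ Finset.range k, x ^ i) := by
  refine hp.summable_mean.of_nonneg_of_le
    (fun k => mul_nonneg (hp.nonneg k) (sum_pow_nonneg hx k)) fun k => ?_
  rw [mul_comm (k : ℝ)]
  exact mul_le_mul_of_nonneg_left (sum_pow_le hx k) (hp.nonneg k)

lemma one_sub_mul_secant {x : ℝ} (hx : x ∈ Set.Icc (0 : ℝ) 1) :
    (1 - x) * secant p x = 1 - pgf p x := by
  have h := hp.hasSum_one.sub (hp.summable_pgf hx).hasSum
  rw [secant, pgf, ← tsum_mul_left, ← h.tsum_eq]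
  congr 1; ext k
  have := mul_neg_geom_sum x k
  linear_combination p k * this

/-- A mean above `1` forces `p k > 0` for some `k ≥ 2`, and the inner sum of that term contains the
strictly increasing monomial `x`. -/
lemma secant_strictMonoOn : StrictMonoOn (secant p) (Set.Icc 0 1) := by
  intro x hx y hy hxy
  obtain ⟨k, hk, hpk⟩ : ∃ k, 2 ≤ k ∧ p k ≠ 0 := by
    by_contra! h
    have h1 : mean p ≤ ∑' k, p k := by
      refine hp.summable_mean.tsum_le_tsum (fun k => ?_) hp.hasSum_one.summable
      rcases lt_or_ge k 2 with hk | hk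
      · exact mul_le_of_le_one_left (hp.nonneg k) (by exact_mod_cast Nat.lt_succ_iff.1 hk)
      · simp [h k hk]
    rw [hp.hasSum_one.tsum_eq] at h1
    exact absurd hp.one_lt_mean (not_lt.2 h1)
  have hle : ∀ k, ∑ i ∈ Finset.range k, x ^ i ≤ ∑ i ∈ Finset.range k, y ^ i := fun k =>
    Finset.sum_le_sum fun i _ => pow_le_pow_left₀ hx.1 hxy.le i
  refine (hp.summable_secant hx).tsum_lt_tsum (i := k)
    (fun k => mul_le_mul_of_nonneg_left (hle k) (hp.nonneg k)) ?_ (hp.summable_secant hy)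
  refine mul_lt_mul_of_pos_left ?_ (lt_of_le_of_ne (hp.nonneg k) hpk.symm)
  exact Finset.sum_lt_sum (fun i _ => pow_le_pow_left₀ hx.1 hxy.le i)
    ⟨1, Finset.mem_range.2 (by omega), by simpa using hxy⟩

lemma continuousOn_secant : ContinuousOn (secant p) (Set.Icc 0 1) := by
  refine continuousOn_tsum (fun k => by fun_prop) hp.summable_mean fun k x hx => ?_
  rw [Real.norm_of_nonneg (mul_nonneg (hp.nonneg k) (sum_pow_nonneg hx k)), mul_comm (k : ℝ)]
  exact mul_le_mul_of_nonneg_left (sum_pow_le hx k) (hp.nonneg k)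

lemma continuousOn_pgf : ContinuousOn (pgf p) (Set.Icc 0 1) := by
  refine continuousOn_tsum (fun k => by fun_prop) hp.hasSum_one.summable fun k x hx => ?_
  rw [Real.norm_of_nonneg (mul_nonneg (hp.nonneg k) (pow_nonneg hx.1 k))]
  exact mul_le_of_le_one_right (hp.nonneg k) (pow_le_one₀ hx.1 hx.2)

lemma pgf_monotoneOn : MonotoneOn (pgf p) (Set.Icc 0 1) := fun _ hx _ hy hxy =>
  (hp.summable_pgf hx).tsum_le_tsum
    (fun k => mul_le_mul_of_nonneg_left (pow_le_pow_left₀ hx.1 hxy k) (hp.nonneg k))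
    (hp.summable_pgf hy)

lemma pgf_one : pgf p 1 = 1 := by
  simp [pgf, hp.hasSum_one.tsum_eq]

lemma pgf_mem {x : ℝ} (hx : x ∈ Set.Icc (0 : ℝ) 1) : pgf p x ∈ Set.Icc (0 : ℝ) 1 :=
  ⟨tsum_nonneg fun k => mul_nonneg (hp.nonneg k) (pow_nonneg hx.1 k),
    hp.pgf_one ▸ hp.pgf_monotoneOn hx (by simp) hx.2⟩

/-- Dividing out the root `1` turns the fixed point equation on `[0, 1)` into `secant p x = 1`,
whose left side is strictly monotone. The sign of `x - f(x)` on either side of `q` is read off from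
this. -/
lemma sub_pgf {x : ℝ} (hx : x ∈ Set.Icc (0 : ℝ) 1) :
    x - pgf p x = (1 - x) * (secant p x - 1) := by
  linear_combination -hp.one_sub_mul_secant hx

lemma exists_secant_eq_one : ∃ q ∈ Set.Ico (0 : ℝ) 1, secant p q = 1 := by
  have h0 : secant p 0 ≤ 1 := by
    have h := hp.one_sub_mul_secant (x := 0) (by simp)
    have := (hp.pgf_mem (x := 0) (by simp)).1
    linarith
  obtain ⟨q, hq, h⟩ := intermediate_value_Ico zero_le_one hp.continuousOn_secant
    (show (1 : ℝ) ∈ Set.Ico (secant p 0) (secant p 1) from ⟨h0, secant_one p ▸ hp.one_lt_mean⟩)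
  exact ⟨q, hq, h⟩

lemma extinctionRoot_spec :
    extinctionRoot p ∈ Set.Ico (0 : ℝ) 1 ∧ secant p (extinctionRoot p) = 1 := by
  obtain ⟨q, hq, h⟩ := hp.exists_secant_eq_one
  have hmem : q ∈ {x : ℝ | 0 ≤ x ∧ pgf p x = x} :=
    ⟨hq.1, by have := hp.sub_pgf ⟨hq.1, hq.2.le⟩; rw [h] at this; linarith⟩
  have : extinctionRoot p = q := by
    refine IsLeast.csInf_eq ⟨hmem, fun x hx => ?_⟩
    by_contra! hxq
    have hx1 : x ∈ Set.Icc (0 : ℝ) 1 := ⟨hx.1, (hxq.trans hq.2).le⟩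
    have h1 := hp.sub_pgf hx1
    have h2 := hp.secant_strictMonoOn hx1 ⟨hq.1, hq.2.le⟩ hxq
    have h3 : 0 < 1 - x := by linarith [hq.2]
    rw [hx.2, h] at *
    nlinarith
  rw [this]
  exact ⟨hq, h⟩

lemma extinctionRoot_mem : extinctionRoot p ∈ Set.Icc (0 : ℝ) 1 :=
  Set.Ico_subset_Icc_self hp.extinctionRoot_spec.1

lemma pgf_extinctionRoot : pgf p (extinctionRoot p) = extinctionRoot p := by
  have := hp.sub_pgf hp.extinctionRoot_mem
  rw [hp.extinctionRoot_spec.2] at this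
  linarith

lemma Ioo_subset : Set.Ioo (extinctionRoot p) 1 ⊆ Set.Icc (0 : ℝ) 1 := fun _ hx =>
  ⟨hp.extinctionRoot_mem.1.trans hx.1.le, hx.2.le⟩

lemma one_lt_secant {x : ℝ} (hx : x ∈ Set.Ioo (extinctionRoot p) 1) : 1 < secant p x :=
  hp.extinctionRoot_spec.2 ▸
    hp.secant_strictMonoOn hp.extinctionRoot_mem (hp.Ioo_subset hx) hx.1

lemma secant_le_mean {x : ℝ} (hx : x ∈ Set.Icc (0 : ℝ) 1) : secant p x ≤ mean p :=
  secant_one p ▸ hp.secant_strictMonoOn.monotoneOn hx (by simp) hx.2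

lemma sub_pgf_pos {x : ℝ} (hx : x ∈ Set.Ioo (extinctionRoot p) 1) : 0 < x - pgf p x := by
  rw [hp.sub_pgf (hp.Ioo_subset hx)]
  exact mul_pos (by linarith [hx.2]) (by linarith [hp.one_lt_secant hx])

lemma sub_pgf_le {x : ℝ} (hx : x ∈ Set.Icc (0 : ℝ) 1) :
    x - pgf p x ≤ (mean p - 1) * (1 - x) := by
  rw [hp.sub_pgf hx, mul_comm]
  exact mul_le_mul_of_nonneg_right (by linarith [hp.secant_le_mean hx]) (by linarith [hx.2])

lemma hasSum_deficit {x : ℝ} (hx : x ∈ Set.Ico (0 : ℝ) 1) :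
    HasSum (fun k => p k * ∑ i ∈ Finset.range k, ∑ j ∈ Finset.range i, x ^ j)
      ((mean p - secant p x) / (1 - x)) := by
  have h1 : (1 - x) ≠ 0 := by linarith [hx.2]
  have h := (hp.summable_mean.hasSum.sub
    (hp.summable_secant (Set.Ico_subset_Icc_self hx)).hasSum).div_const (1 - x)
  refine h.congr_fun fun k => ?_
  rw [eq_div_iff h1, mul_assoc, Finset.sum_mul]
  simp_rw [geom_sum_mul_neg]
  simp
  ring

lemma deficit_eq {x : ℝ} (hx : x ∈ Set.Ico (0 : ℝ) 1) :
    deficit p x = (mean p - secant p x) / (1 - x) := (hp.hasSum_deficit hx).tsum_eq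

lemma continuousOn_deficit : ContinuousOn (deficit p) (Set.Ico 0 1) := by
  refine ContinuousOn.congr ?_ fun x hx => hp.deficit_eq hx
  exact (continuousOn_const.sub (hp.continuousOn_secant.mono Set.Ico_subset_Icc_self)).div
    (by fun_prop) fun x hx => by linarith [hx.2]

lemma deficit_nonneg {x : ℝ} (hx : x ∈ Set.Ico (0 : ℝ) 1) : 0 ≤ deficit p x := by
  rw [hp.deficit_eq hx]
  exact div_nonneg (by linarith [hp.secant_le_mean (Set.Ico_subset_Icc_self hx)])
    (by linarith [hx.2])

/-- The poles at `1` cancel, leaving a nonnegative series over a factor that stays away from `0`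
near `1`. -/
lemma excess_eq {x : ℝ} (hx : x ∈ Set.Ioo (extinctionRoot p) 1) :
    excess p x = deficit p x / (secant p x - 1) := by
  have h1 : (1 - x) ≠ 0 := by linarith [hx.2]
  have h2 : secant p x - 1 ≠ 0 := by linarith [hp.one_lt_secant hx]
  have hx' := hp.Ioo_subset hx
  rw [excess, hp.sub_pgf hx', hp.deficit_eq ⟨hx'.1, hx.2⟩]
  field_simp
  ring

lemma excess_nonneg {x : ℝ} (hx : x ∈ Set.Ioo (extinctionRoot p) 1) : 0 ≤ excess p x := by
  rw [hp.excess_eq hx]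
  exact div_nonneg (hp.deficit_nonneg ⟨(hp.Ioo_subset hx).1, hx.2⟩)
    (by linarith [hp.one_lt_secant hx])

lemma continuousOn_excess : ContinuousOn (excess p) (Set.Ioo (extinctionRoot p) 1) := by
  refine ContinuousOn.sub ?_ ?_
  · exact continuousOn_const.div
      (continuousOn_id.sub (hp.continuousOn_pgf.mono hp.Ioo_subset))
      fun x hx => (hp.sub_pgf_pos hx).ne'
  · exact continuousOn_const.div (by fun_prop) fun x hx => by linarith [hx.2]

end IsSupercritical

/-! ### The `k log k` condition as integrability near `1` -/

lemma sum_harmonic (k : ℕ) :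
    ∑ i ∈ Finset.range k, (harmonic i : ℝ) = k * (harmonic k : ℝ) - k := by
  induction k with
  | zero => simp
  | succ k ih =>
    rw [Finset.sum_range_succ, ih, harmonic_succ]
    push_cast
    field_simp
    ring

lemma lintegral_deficit_term {c : ℝ} (hc : 0 ≤ c) (k : ℕ) :
    ∫⁻ x in Set.Ioo (0 : ℝ) 1,
      ENNReal.ofReal (c * ∑ i ∈ Finset.range k, ∑ j ∈ Finset.range i, x ^ j)
      = ENNReal.ofReal (c * (k * (harmonic k : ℝ) - k)) := by
  have hcont : Continuous fun x : ℝ => c * ∑ i ∈ Finset.range k, ∑ j ∈ Finset.range i, x ^ j := by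
    fun_prop
  rw [← ofReal_integral_eq_lintegral_ofReal
    ((hcont.integrableOn_Icc (a := 0) (b := 1)).mono_set Set.Ioo_subset_Icc_self)
    ((ae_restrict_iff' measurableSet_Ioo).2 (Eventually.of_forall fun x hx => mul_nonneg hc
      (Finset.sum_nonneg fun i _ => Finset.sum_nonneg fun j _ => pow_nonneg hx.1.le j))),
    ← integral_Ioc_eq_integral_Ioo, ← intervalIntegral.integral_of_le zero_le_one,
    intervalIntegral.integral_const_mul, intervalIntegral.integral_finsetSum
      (fun i _ => Continuous.intervalIntegrable (by fun_prop) _ _), ← sum_harmonic]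
  congr 2
  refine Finset.sum_congr rfl fun i _ => ?_
  rw [intervalIntegral.integral_finsetSum
      (fun i _ => Continuous.intervalIntegrable (by fun_prop) _ _), harmonic]
  simp

namespace IsSupercritical

variable {p : ℕ → ℝ} (hp : IsSupercritical p)
include hp

lemma mul_log_le (k : ℕ) : p k * k * Real.log k ≤ p k * (k * (harmonic k : ℝ) - k) + k * p k := by
  have h1 : Real.log k ≤ harmonic k := by
    rcases Nat.eq_zero_or_pos k with rfl | hk
    · simp
    · refine le_trans (Real.log_le_log (by exact_mod_cast hk) ?_) (log_add_one_le_harmonic k)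
      push_cast; linarith
  have := mul_le_mul_of_nonneg_left h1 (mul_nonneg (hp.nonneg k) k.cast_nonneg)
  linarith

lemma le_mul_log (k : ℕ) : p k * (k * (harmonic k : ℝ) - k) ≤ p k * k * Real.log k := by
  have := mul_le_mul_of_nonneg_left (harmonic_le_one_add_log k)
    (mul_nonneg (hp.nonneg k) k.cast_nonneg)
  linarith

lemma mul_harmonic_nonneg (k : ℕ) : 0 ≤ p k * (k * (harmonic k : ℝ) - k) := by
  refine mul_nonneg (hp.nonneg k) ?_
  rw [← sum_harmonic]
  refine Finset.sum_nonneg fun i _ => ?_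
  simp only [harmonic]
  positivity

lemma summable_log_iff : Summable (fun k : ℕ => p k * k * Real.log k) ↔
    Summable (fun k : ℕ => p k * (k * (harmonic k : ℝ) - k)) :=
  ⟨fun h => h.of_nonneg_of_le hp.mul_harmonic_nonneg hp.le_mul_log,
    fun h => (h.add hp.summable_mean).of_nonneg_of_le
      (fun k => mul_nonneg (mul_nonneg (hp.nonneg k) k.cast_nonneg) (Real.log_natCast_nonneg k))
      hp.mul_log_le⟩

/-- All terms are nonnegative, so Tonelli allows termwise integration. The `k`-th integral is `p k *
(k * H_k - k)`, and `H_k` differs from `log k` by at most `1`; the finite mean absorbs the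
difference. -/
lemma integrableOn_deficit_iff : IntegrableOn (deficit p) (Set.Ioo 0 1) ↔
    Summable (fun k : ℕ => p k * k * Real.log k) := by
  have hm : AEStronglyMeasurable (deficit p) (volume.restrict (Set.Ioo 0 1)) :=
    (hp.continuousOn_deficit.mono Set.Ioo_subset_Ico_self).aestronglyMeasurable measurableSet_Ioo
  have hnn : 0 ≤ᵐ[volume.restrict (Set.Ioo (0 : ℝ) 1)] deficit p :=
    (ae_restrict_iff' measurableSet_Ioo).2
      (Eventually.of_forall fun x hx => hp.deficit_nonneg ⟨hx.1.le, hx.2⟩)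
  have hint : ∫⁻ x in Set.Ioo (0 : ℝ) 1, ENNReal.ofReal (deficit p x)
      = ∑' k, ENNReal.ofReal (p k * (k * (harmonic k : ℝ) - k)) := by
    simp_rw [← fun k => lintegral_deficit_term (hp.nonneg k) k]
    rw [← lintegral_tsum fun k => by fun_prop]
    refine setLIntegral_congr_fun measurableSet_Ioo fun x hx => ?_
    exact ENNReal.ofReal_tsum_of_nonneg (fun k => mul_nonneg (hp.nonneg k)
      (Finset.sum_nonneg fun i _ => Finset.sum_nonneg fun j _ => pow_nonneg hx.1.le j))
      (hp.hasSum_deficit ⟨hx.1.le, hx.2⟩).summable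
  rw [hp.summable_log_iff, IntegrableOn, Integrable, and_iff_right hm,
    hasFiniteIntegral_iff_ofReal hnn, hint]
  constructor
  · intro h
    have := ENNReal.summable_toReal h.ne
    simpa only [ENNReal.toReal_ofReal (hp.mul_harmonic_nonneg _)] using this
  · exact fun h => h.tsum_ofReal_lt_top

/-- On `(y, 1)` the denominator `secant p x - 1` lies between `secant p y - 1 > 0` and `mean p - 1`,
so `excess` and `deficit` are comparable there. On `[0, y]` the function `deficit` is continuous. -/
lemma integrableOn_excess_iff {y : ℝ} (hy : y ∈ Set.Ioo (extinctionRoot p) 1) :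
    IntegrableOn (excess p) (Set.Ioo y 1) ↔ Summable (fun k : ℕ => p k * k * Real.log k) := by
  have hy0 := (hp.Ioo_subset hy).1
  have hsub : Set.Ioo y 1 ⊆ Set.Ioo (extinctionRoot p) 1 := Set.Ioo_subset_Ioo_left hy.1.le
  have hsub' : Set.Ioo y 1 ⊆ Set.Ico 0 1 := fun x hx => ⟨hy0.trans hx.1.le, hx.2⟩
  have hb : 0 < secant p y - 1 := by linarith [hp.one_lt_secant hy]
  have ha : 0 < mean p - 1 := by linarith [hp.one_lt_mean]
  have hlow : ∀ x ∈ Set.Ioo y 1, secant p y ≤ secant p x := fun x hx =>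
    hp.secant_strictMonoOn.monotoneOn (hp.Ioo_subset hy) (hp.Ioo_subset (hsub hx)) hx.1.le
  have h1 : IntegrableOn (excess p) (Set.Ioo y 1) ↔ IntegrableOn (deficit p) (Set.Ioo y 1) := by
    constructor
    · intro h
      refine Integrable.mono' (h.const_mul (mean p - 1))
        ((hp.continuousOn_deficit.mono hsub').aestronglyMeasurable measurableSet_Ioo)
        ((ae_restrict_iff' measurableSet_Ioo).2 (Eventually.of_forall fun x hx => ?_))
      have h2 : 0 < secant p x - 1 := by linarith [hlow x hx]
      have h3 := hp.secant_le_mean (hp.Ioo_subset (hsub hx))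
      have h4 := hp.deficit_nonneg (hsub' hx)
      rw [Real.norm_of_nonneg h4, hp.excess_eq (hsub hx), ← mul_div_assoc, le_div_iff₀ h2,
        mul_comm]
      exact mul_le_mul_of_nonneg_right (by linarith) h4
    · intro h
      refine Integrable.mono' (h.div_const (secant p y - 1))
        ((hp.continuousOn_excess.mono hsub).aestronglyMeasurable measurableSet_Ioo)
        ((ae_restrict_iff' measurableSet_Ioo).2 (Eventually.of_forall fun x hx => ?_))
      have h4 := hp.deficit_nonneg (hsub' hx)
      rw [Real.norm_of_nonneg (hp.excess_nonneg (hsub hx)), hp.excess_eq (hsub hx)]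
      exact div_le_div_of_nonneg_left h4 hb (by linarith [hlow x hx])
  rw [h1, ← hp.integrableOn_deficit_iff]
  refine ⟨fun h => ?_, fun h => h.mono_set (Set.Ioo_subset_Ioo_left hy0)⟩
  have h2 : IntegrableOn (deficit p) (Set.Icc 0 y) :=
    (hp.continuousOn_deficit.mono fun x hx => ⟨hx.1, hx.2.trans_lt hy.2⟩).integrableOn_Icc
  refine (h2.union h).mono_set fun x hx => ?_
  rcases le_or_gt x y with h3 | h3
  · exact Or.inl ⟨hx.1.le, h3⟩
  · exact Or.inr ⟨h3, hx.2⟩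

end IsSupercritical

/-! ### Tail generating functions as iterated resolvents of the shift -/

/-- The sequence `c ↦ ∑ a^i v_{c+i}` of the tails of a power series, evaluated at `a`. -/
def shiftSum (a : ℝ≥0∞) (v : ℕ → ℝ≥0∞) (c : ℕ) : ℝ≥0∞ := ∑' i : ℕ, a ^ i * v (c + i)

/-- With `S` the shift `(S v) c = v (c + 1)`, this says that `shiftSum a` acts as `(1 - a S)⁻¹`.
Such operators commute and satisfy the resolvent identity, written below without subtraction because
the values are in `ℝ≥0∞`. -/
lemma shiftSum_eq_add (a : ℝ≥0∞) (v : ℕ → ℝ≥0∞) (c : ℕ) :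
    shiftSum a v c = v c + a * shiftSum a v (c + 1) := by
  rw [shiftSum, tsum_eq_zero_add' ENNReal.summable, shiftSum, ← ENNReal.tsum_mul_left]
  simp only [pow_zero, one_mul, add_zero, pow_succ']
  congr 2; ext i
  rw [mul_assoc, show c + (i + 1) = c + 1 + i by ring]

lemma shiftSum_comm (a b : ℝ≥0∞) (v : ℕ → ℝ≥0∞) :
    shiftSum a (shiftSum b v) = shiftSum b (shiftSum a v) := by
  ext c
  simp only [shiftSum, ← ENNReal.tsum_mul_left]
  rw [ENNReal.tsum_comm]
  refine tsum_congr fun i => tsum_congr fun j => ?_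
  rw [show c + j + i = c + i + j by ring]
  ring

lemma shiftSum_resolvent (a b : ℝ≥0∞) (v : ℕ → ℝ≥0∞) (c : ℕ) :
    a * shiftSum a (shiftSum b v) (c + 1) + shiftSum b v c
      = b * shiftSum a (shiftSum b v) (c + 1) + shiftSum a v c := by
  rw [add_comm, ← shiftSum_eq_add, shiftSum_comm, shiftSum_eq_add b, add_comm]

lemma toReal_shiftSum_resolvent {a b : ℝ} (ha : 0 ≤ a) (hb : 0 ≤ b) {v : ℕ → ℝ≥0∞} (c : ℕ)
    (h1 : ∀ c, shiftSum (.ofReal a) (shiftSum (.ofReal b) v) c ≠ ⊤)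
    (h2 : ∀ c, shiftSum (.ofReal a) v c ≠ ⊤) (h3 : ∀ c, shiftSum (.ofReal b) v c ≠ ⊤) :
    (a - b) * (shiftSum (.ofReal a) (shiftSum (.ofReal b) v) (c + 1)).toReal
      = (shiftSum (.ofReal a) v c).toReal - (shiftSum (.ofReal b) v c).toReal := by
  have h := congrArg ENNReal.toReal (shiftSum_resolvent (.ofReal a) (.ofReal b) v c)
  rw [ENNReal.toReal_add (ENNReal.mul_ne_top ENNReal.ofReal_ne_top (h1 _)) (h3 _),
    ENNReal.toReal_add (ENNReal.mul_ne_top ENNReal.ofReal_ne_top (h1 _)) (h2 _),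
    ENNReal.toReal_mul, ENNReal.toReal_mul, ENNReal.toReal_ofReal ha, ENNReal.toReal_ofReal hb] at h
  linarith

/-- The coefficient `w (n + 1)` is met once for each of the `n + 1` pairs with sum `n`, which
produces the factor `k` of the derivative. -/
lemma shiftSum_self_one (a : ℝ≥0∞) (w : ℕ → ℝ≥0∞) :
    shiftSum a (shiftSum a w) 1 = ∑' k : ℕ, (k : ℝ≥0∞) * w k * a ^ (k - 1) := by
  rw [tsum_eq_zero_add' ENNReal.summable]
  simp only [shiftSum, ← ENNReal.tsum_mul_left, CharP.cast_eq_zero, zero_mul, zero_add]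
  rw [← ENNReal.tsum_prod,
    ← Equiv.tsum_eq (Finset.HasAntidiagonal.sigmaAntidiagonalEquivProd (A := ℕ)), ENNReal.tsum_sigma']
  refine tsum_congr fun n => ?_
  rw [tsum_fintype]
  have : ∀ x : Finset.HasAntidiagonal.antidiagonal n, a ^ (x : ℕ × ℕ).1 * (a ^ (x : ℕ × ℕ).2 *
      w (1 + (x : ℕ × ℕ).1 + (x : ℕ × ℕ).2)) = w (n + 1) * a ^ n := by
    intro x
    have hx := Finset.HasAntidiagonal.mem_antidiagonal.1 x.2
    rw [show 1 + (x : ℕ × ℕ).1 + (x : ℕ × ℕ).2 = n + 1 by omega, ← mul_assoc, ← pow_add, hx, mul_comm]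
  simp only [Finset.HasAntidiagonal.sigmaAntidiagonalEquivProd, Equiv.coe_fn_mk, this]
  simp [mul_assoc]

lemma shiftSum_ne_top_of_lt_one {a : ℝ≥0∞} (ha : a < 1) {v : ℕ → ℝ≥0∞}
    (hv : ∃ B ≠ ⊤, ∀ c, v c ≤ B) : ∃ B ≠ ⊤, ∀ c, shiftSum a v c ≤ B := by
  obtain ⟨B, hB, h⟩ := hv
  refine ⟨(1 - a)⁻¹ * B, ENNReal.mul_ne_top ?_ hB, fun c => ?_⟩
  · exact ENNReal.inv_ne_top.2 (tsub_pos_of_lt ha).ne'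
  · rw [← ENNReal.tsum_geometric, ← ENNReal.tsum_mul_right]
    exact ENNReal.tsum_le_tsum fun i => mul_le_mul_right (h _) _

lemma shiftSum_one_le {v : ℕ → ℝ≥0∞} (c : ℕ) : shiftSum 1 v c ≤ shiftSum 1 v 0 := by
  induction c with
  | zero => exact le_rfl
  | succ c ih =>
    refine le_trans ?_ ih
    rw [shiftSum_eq_add 1 v c, one_mul]
    exact le_add_self

lemma tsum_fin_succ {n : ℕ} (w : ℕ → ℝ≥0∞) (s : Fin (n + 1) → ℝ≥0∞) (c : ℕ) :
    ∑' i : Fin (n + 1) → ℕ, w (c + ∑ k, i k) * ∏ k, s k ^ i k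
      = shiftSum (s 0) (fun c => ∑' i : Fin n → ℕ, w (c + ∑ k, i k) *
          ∏ k, (Fin.tail s) k ^ i k) c := by
  rw [← (Fin.consEquiv fun _ : Fin (n + 1) => ℕ).tsum_eq, ENNReal.tsum_prod', shiftSum]
  refine tsum_congr fun i => ?_
  rw [← ENNReal.tsum_mul_left]
  refine tsum_congr fun j => ?_
  simp only [Fin.consEquiv, Equiv.coe_fn_mk, Fin.sum_univ_succ, Fin.prod_univ_succ, Fin.cons_zero,
    Fin.cons_succ, Fin.tail, add_assoc]
  ring

lemma tailGF_eq {p : ℕ → ℝ} (hp : ∀ k, 0 ≤ p k) {n : ℕ} (s : Fin n → ℝ) (hs : ∀ k, 0 ≤ s k) :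
    tailGF p s = (∑' i : Fin n → ℕ, ENNReal.ofReal (p ((n - 1) + ∑ k, i k)) *
      ∏ k, ENNReal.ofReal (s k) ^ i k).toReal := by
  rw [tailGF, ENNReal.tsum_toReal_eq fun i => ENNReal.mul_ne_top ENNReal.ofReal_ne_top
    (ENNReal.prod_ne_top fun k _ => ENNReal.pow_ne_top ENNReal.ofReal_ne_top)]
  refine tsum_congr fun i => ?_
  rw [ENNReal.toReal_mul, ENNReal.toReal_ofReal (hp _), ENNReal.toReal_prod, add_comm]
  congr 1
  refine Finset.prod_congr rfl fun k _ => ?_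
  rw [ENNReal.toReal_pow, ENNReal.toReal_ofReal (hs k)]

lemma tailGF_three {p : ℕ → ℝ} (hp : ∀ k, 0 ≤ p k) {a b c : ℝ} (ha : 0 ≤ a) (hb : 0 ≤ b)
    (hc : 0 ≤ c) : tailGF p ![a, b, c] = (shiftSum (.ofReal a) (shiftSum (.ofReal b)
      (shiftSum (.ofReal c) fun k => .ofReal (p k))) 2).toReal := by
  rw [tailGF_eq hp _ (by simp [Fin.forall_fin_succ, ha, hb, hc])]
  have := fun (n : ℕ) => tsum_fin_succ (n := n) fun k => ENNReal.ofReal (p k)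
  simp only [this]
  simp [Fin.tail]

lemma tailGF_four {p : ℕ → ℝ} (hp : ∀ k, 0 ≤ p k) {a b c d : ℝ} (ha : 0 ≤ a) (hb : 0 ≤ b)
    (hc : 0 ≤ c) (hd : 0 ≤ d) : tailGF p ![a, b, c, d] = (shiftSum (.ofReal a)
      (shiftSum (.ofReal b) (shiftSum (.ofReal c)
        (shiftSum (.ofReal d) fun k => .ofReal (p k)))) 3).toReal := by
  rw [tailGF_eq hp _ (by simp [Fin.forall_fin_succ, ha, hb, hc, hd])]
  have := fun (n : ℕ) => tsum_fin_succ (n := n) fun k => ENNReal.ofReal (p k)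
  simp only [this]
  simp [Fin.tail]

lemma toReal_shiftSum_zero {p : ℕ → ℝ} (hp : ∀ k, 0 ≤ p k) {x : ℝ} (hx : 0 ≤ x) :
    (shiftSum (.ofReal x) (fun k => .ofReal (p k)) 0).toReal = pgf p x := by
  rw [shiftSum, ENNReal.tsum_toReal_eq fun i => ENNReal.mul_ne_top
    (ENNReal.pow_ne_top ENNReal.ofReal_ne_top) ENNReal.ofReal_ne_top, pgf]
  refine tsum_congr fun i => ?_
  rw [zero_add, ENNReal.toReal_mul, ENNReal.toReal_ofReal (hp _), ENNReal.toReal_pow,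
    ENNReal.toReal_ofReal hx, mul_comm]

lemma toReal_shiftSum_self_one {p : ℕ → ℝ} (hp : ∀ k, 0 ≤ p k) {x : ℝ} (hx : 0 ≤ x) :
    (shiftSum (.ofReal x) (shiftSum (.ofReal x) (fun k => .ofReal (p k))) 1).toReal
      = pgfDeriv p x := by
  rw [shiftSum_self_one, ENNReal.tsum_toReal_eq fun i => ENNReal.mul_ne_top
    (ENNReal.mul_ne_top (ENNReal.natCast_ne_top _) ENNReal.ofReal_ne_top)
    (ENNReal.pow_ne_top ENNReal.ofReal_ne_top), pgfDeriv]
  refine tsum_congr fun i => ?_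
  rw [ENNReal.toReal_mul, ENNReal.toReal_mul, ENNReal.toReal_ofReal (hp _), ENNReal.toReal_pow,
    ENNReal.toReal_ofReal hx, ENNReal.toReal_natCast]

lemma pgfDeriv_one (p : ℕ → ℝ) : pgfDeriv p 1 = mean p := by
  simp [pgfDeriv, mean]

namespace IsSupercritical

variable {p : ℕ → ℝ} (hp : IsSupercritical p)
include hp

lemma shiftSum_one_ne_top :
    ∃ B ≠ ⊤, ∀ c, shiftSum (.ofReal 1) (fun k => ENNReal.ofReal (p k)) c ≤ B := by
  rw [ENNReal.ofReal_one]
  refine ⟨_, ?_, shiftSum_one_le⟩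
  simpa [shiftSum] using hp.hasSum_one.summable.tsum_ofReal_ne_top

lemma shiftSum_one_one_ne_top : ∃ B ≠ ⊤, ∀ c,
    shiftSum (.ofReal 1) (shiftSum (.ofReal 1) fun k => ENNReal.ofReal (p k)) c ≤ B := by
  obtain ⟨B, hB, h⟩ := hp.shiftSum_one_ne_top
  rw [ENNReal.ofReal_one] at *
  refine ⟨_, ?_, shiftSum_one_le⟩
  rw [shiftSum_eq_add, one_mul]
  refine ENNReal.add_ne_top.2 ⟨ne_top_of_le_ne_top hB (h 0), ?_⟩
  rw [shiftSum_self_one]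
  have := hp.summable_mean.tsum_ofReal_ne_top
  simpa [ENNReal.ofReal_mul] using this

/-- Each resolvent identity is a divided difference relation, so `f⁽³⁾(q,1,x)` is the second divided
difference of `f` at `q, 1, x`, and the two `f⁽⁴⁾` are third divided differences with a repeated
node. As `q` and `1` are fixed points, everything reduces to `f(x)`, `f'(q)` and `f'(1)`. -/
lemma psi_eq {x : ℝ} (hx : x ∈ Set.Ioo (extinctionRoot p) 1) :
    psi p (extinctionRoot p) 1 x
      = 1 / (x - extinctionRoot p) - gam p (extinctionRoot p) 1 * excess p x := by
  have hq := hp.extinctionRoot_spec.1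
  have hfq := hp.pgf_extinctionRoot
  have hgpos := hp.sub_pgf_pos hx
  rw [psi, gam, pgfDeriv_one, excess]
  set q := extinctionRoot p with hqdef
  have hx0 : 0 ≤ x := hq.1.trans hx.1.le
  set w : ℕ → ℝ≥0∞ := fun k => ENNReal.ofReal (p k) with hw
  have hQ : ENNReal.ofReal q < 1 := by simpa using hq.2
  have hX : ENNReal.ofReal x < 1 := by simpa using hx.2
  have bw : ∃ B ≠ ⊤, ∀ c, w c ≤ B :=
    ⟨1, ENNReal.one_ne_top, fun c => by
      simpa [hw] using le_hasSum hp.hasSum_one c fun k _ => hp.nonneg k⟩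
  have b1 := hp.shiftSum_one_ne_top
  have b11 := hp.shiftSum_one_one_ne_top
  have fin : ∀ {v : ℕ → ℝ≥0∞}, (∃ B ≠ ⊤, ∀ c, v c ≤ B) → ∀ c, v c ≠ ⊤ :=
    fun ⟨B, hB, h⟩ c => ne_top_of_le_ne_top hB (h c)
  have bq1 := shiftSum_ne_top_of_lt_one hQ b1
  have bq11 := shiftSum_ne_top_of_lt_one hQ b11
  have bqq1 := shiftSum_ne_top_of_lt_one hQ bq1
  have bq := shiftSum_ne_top_of_lt_one hQ bw
  have bqq := shiftSum_ne_top_of_lt_one hQ bq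
  have bx := shiftSum_ne_top_of_lt_one hX bw
  have bxq := shiftSum_ne_top_of_lt_one hX bq
  have bxq1 := shiftSum_ne_top_of_lt_one hX bq1
  have b1q : ∃ B ≠ ⊤, ∀ c, shiftSum (.ofReal 1) (shiftSum (.ofReal q) w) c ≤ B := by
    rw [shiftSum_comm]; exact bq1
  have b1q1 : ∃ B ≠ ⊤, ∀ c,
      shiftSum (.ofReal 1) (shiftSum (.ofReal q) (shiftSum (.ofReal 1) w)) c ≤ B := by
    rw [shiftSum_comm]; exact bq11
  have b1qq : ∃ B ≠ ⊤, ∀ c,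
      shiftSum (.ofReal 1) (shiftSum (.ofReal q) (shiftSum (.ofReal q) w)) c ≤ B := by
    rw [shiftSum_comm, shiftSum_comm (.ofReal 1)]; exact bqq1
  have e1 := toReal_shiftSum_resolvent hx0 hq.1 2
    (fin (shiftSum_ne_top_of_lt_one hX bqq1)) (fin bxq1) (fin bqq1)
  have e2 := toReal_shiftSum_resolvent hx0 zero_le_one 2
    (fin (shiftSum_ne_top_of_lt_one hX b1q1)) (fin bxq1) (fin b1q1)
  have e3 := toReal_shiftSum_resolvent hx0 zero_le_one 1
    (fin (shiftSum_ne_top_of_lt_one hX b1q)) (fin bxq) (fin b1q)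
  have e4 := toReal_shiftSum_resolvent hx0 hq.1 0 (fin bxq) (fin bx) (fin bq)
  have e5 := toReal_shiftSum_resolvent zero_le_one hq.1 0 (fin b1q) (fin b1) (fin bq)
  have e6 := toReal_shiftSum_resolvent zero_le_one hq.1 1 (fin b1qq) (fin b1q) (fin bqq)
  have e7 := toReal_shiftSum_resolvent zero_le_one hq.1 1 (fin b1q1) (fin b11) (fin bq1)
  norm_num only at e1 e2 e3 e4 e5 e6 e7
  rw [tailGF_three hp.nonneg hq.1 zero_le_one hx0, tailGF_four hp.nonneg hq.1 hq.1 zero_le_one hx0,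
    tailGF_four hp.nonneg hq.1 zero_le_one zero_le_one hx0]
  rw [toReal_shiftSum_self_one hp.nonneg hq.1] at e6
  have c6 : shiftSum (.ofReal q) (shiftSum (.ofReal 1) w) 1
      = shiftSum (.ofReal 1) (shiftSum (.ofReal q) w) 1 := by
    rw [shiftSum_comm]
  rw [toReal_shiftSum_self_one hp.nonneg zero_le_one, pgfDeriv_one, c6] at e7
  rw [toReal_shiftSum_zero hp.nonneg hx0, toReal_shiftSum_zero hp.nonneg hq.1, hfq] at e4
  rw [toReal_shiftSum_zero hp.nonneg zero_le_one, toReal_shiftSum_zero hp.nonneg hq.1, hfq,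
    hp.pgf_one] at e5
  have c1 : shiftSum (.ofReal q) (shiftSum (.ofReal 1) (shiftSum (.ofReal x) w))
      = shiftSum (.ofReal x) (shiftSum (.ofReal q) (shiftSum (.ofReal 1) w)) := by
    rw [shiftSum_comm (.ofReal 1), shiftSum_comm (.ofReal q)]
  have c2 : shiftSum (.ofReal q) (shiftSum (.ofReal q) (shiftSum (.ofReal 1) (shiftSum (.ofReal x) w)))
      = shiftSum (.ofReal x) (shiftSum (.ofReal q) (shiftSum (.ofReal q) (shiftSum (.ofReal 1) w))) := by
    rw [c1, shiftSum_comm (.ofReal q)]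
  have c3 : shiftSum (.ofReal q) (shiftSum (.ofReal 1) (shiftSum (.ofReal 1) (shiftSum (.ofReal x) w)))
      = shiftSum (.ofReal x) (shiftSum (.ofReal 1) (shiftSum (.ofReal q) (shiftSum (.ofReal 1) w))) := by
    rw [shiftSum_comm (.ofReal q), c1, shiftSum_comm (.ofReal 1)]
  have c4 : shiftSum (.ofReal x) (shiftSum (.ofReal 1) (shiftSum (.ofReal q) w))
      = shiftSum (.ofReal x) (shiftSum (.ofReal q) (shiftSum (.ofReal 1) w)) := by
    rw [shiftSum_comm (.ofReal 1)]
  have c5 : shiftSum (.ofReal 1) (shiftSum (.ofReal q) (shiftSum (.ofReal q) w))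
      = shiftSum (.ofReal q) (shiftSum (.ofReal q) (shiftSum (.ofReal 1) w)) := by
    rw [shiftSum_comm (.ofReal 1), shiftSum_comm (.ofReal 1)]
  rw [c2, c3, c1]
  rw [c4] at e3
  rw [c5] at e6
  generalize (shiftSum (.ofReal x) (shiftSum (.ofReal q)
    (shiftSum (.ofReal q) (shiftSum (.ofReal 1) w))) 3).toReal = A at *
  generalize (shiftSum (.ofReal x) (shiftSum (.ofReal 1)
    (shiftSum (.ofReal q) (shiftSum (.ofReal 1) w))) 3).toReal = B at *
  generalize (shiftSum (.ofReal x) (shiftSum (.ofReal q) (shiftSum (.ofReal 1) w)) 2).toReal = C at *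
  generalize (shiftSum (.ofReal q) (shiftSum (.ofReal q) (shiftSum (.ofReal 1) w)) 2).toReal = D at *
  generalize (shiftSum (.ofReal 1) (shiftSum (.ofReal q) (shiftSum (.ofReal 1) w)) 2).toReal = E at *
  generalize (shiftSum (.ofReal x) (shiftSum (.ofReal q) w) 1).toReal = F at *
  generalize (shiftSum (.ofReal 1) (shiftSum (.ofReal q) w) 1).toReal = G at *
  have hq1 : 1 - q ≠ 0 := by linarith [hq.2]
  have hx1 : 1 - x ≠ 0 := by linarith [hx.2]
  have hxq : x - q ≠ 0 := by linarith [hx.1]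
  have hm : mean p - 1 ≠ 0 := by linarith [hp.one_lt_mean]
  -- `G` is the slope of `f` between the fixed points `q` and `1`.
  have hG : G = 1 := mul_left_cancel₀ hq1 (by linarith)
  subst hG
  have hg : x - pgf p x = (x - q) * (1 - x) * C := by linear_combination (x - q) * e3 + e4
  have hC : C ≠ 0 := by
    rintro rfl
    rw [mul_zero] at hg
    exact hgpos.ne' hg
  have hA : A = (C - D) / (x - q) := by rw [eq_div_iff hxq]; linarith
  have hB : B = (E - C) / (1 - x) := by rw [eq_div_iff hx1]; linarith
  have hE : E = (mean p - 1) / (1 - q) := by rw [eq_div_iff hq1]; linarith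
  have hD : 1 - pgfDeriv p q = (1 - q) * D := by linarith
  rw [hg, hD, hA, hB, hE]
  field_simp
  ring

end IsSupercritical

/-! ### The semigroup of generating functions and its backward equation -/

/-- The generating function `E x^{Z_t}` of the population started from one particle. -/
def genFun (P : ℝ≥0 → ℕ → ℕ → ℝ) (t : ℝ≥0) (x : ℝ) : ℝ := ∑' j : ℕ, P t 1 j * x ^ j

namespace IsBranchingSemigroup

variable {p : ℕ → ℝ} {P : ℝ≥0 → ℕ → ℕ → ℝ} (hP : IsBranchingSemigroup p P)
include hP

lemma summable_pow (t : ℝ≥0) (i : ℕ) {x : ℝ} (hx : x ∈ Set.Icc (0 : ℝ) 1) :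
    Summable (fun j => P t i j * x ^ j) :=
  (hP.hasSum_one t i).summable.of_nonneg_of_le
    (fun j => mul_nonneg (hP.nonneg t i j) (pow_nonneg hx.1 j))
    fun j => mul_le_of_le_one_right (hP.nonneg t i j) (pow_le_one₀ hx.1 hx.2)

lemma genFun_mem (t : ℝ≥0) {x : ℝ} (hx : x ∈ Set.Icc (0 : ℝ) 1) :
    genFun P t x ∈ Set.Icc (0 : ℝ) 1 := by
  refine ⟨tsum_nonneg fun j => mul_nonneg (hP.nonneg t 1 j) (pow_nonneg hx.1 j), ?_⟩
  rw [← (hP.hasSum_one t 1).tsum_eq]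
  exact (hP.summable_pow t 1 hx).tsum_le_tsum
    (fun j => mul_le_of_le_one_right (hP.nonneg t 1 j) (pow_le_one₀ hx.1 hx.2))
    (hP.hasSum_one t 1).summable

lemma genFun_zero (x : ℝ) : genFun P 0 x = x := by
  rw [genFun, tsum_eq_single 1 fun j hj => by simp [hP.zero, Ne.symm hj]]
  simp [hP.zero]

lemma genFun_add (s t : ℝ≥0) {x : ℝ} (hx : x ∈ Set.Icc (0 : ℝ) 1) :
    genFun P (s + t) x = genFun P s (genFun P t x) := by
  have hin : ∀ k, HasSum (fun j => P s 1 k * P t k j * x ^ j) (P s 1 k * genFun P t x ^ k) := by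
    intro k
    have h := (hP.summable_pow t k hx).hasSum
    rw [hP.branching t k x hx] at h
    exact (h.mul_left (P s 1 k)).congr_fun fun j => mul_assoc _ _ _
  have hsum : Summable (Function.uncurry fun k j => P s 1 k * P t k j * x ^ j) := by
    refine (summable_prod_of_nonneg fun y => ?_).2 ⟨fun k => (hin k).summable, ?_⟩
    · exact mul_nonneg (mul_nonneg (hP.nonneg _ _ _) (hP.nonneg _ _ _)) (pow_nonneg hx.1 _)
    · refine (hP.summable_pow s 1 (hP.genFun_mem t hx)).congr fun k => ?_
      exact (hin k).tsum_eq.symm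
  calc genFun P (s + t) x = ∑' j, ∑' k, P s 1 k * P t k j * x ^ j := by
        refine tsum_congr fun j => ?_
        rw [tsum_mul_right, (hP.chapman_kolmogorov s t 1 j).tsum_eq]
    _ = ∑' k, ∑' j, P s 1 k * P t k j * x ^ j := Summable.tsum_comm hsum
    _ = genFun P s (genFun P t x) := tsum_congr fun k => (hin k).tsum_eq

/-- The rates are given only entrywise; a Scheffé argument makes them uniform in `y`. The errors `d
h j` sum to `0`, so their `ℓ¹` norm is twice the mass of their negative parts, and for large `j` the
negative part is at most `p j * h`. -/
lemma genFun_infinitesimal (hp : IsSupercritical p) {ε : ℝ} (hε : 0 < ε) :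
    ∀ᶠ h : ℝ≥0 in 𝓝 0, ∀ y ∈ Set.Icc (0 : ℝ) 1,
      |genFun P h y - y - h * (pgf p y - y)| ≤ ε * h := by
  set d : ℝ≥0 → ℕ → ℝ := fun h j => P h 1 j - ((if j = 1 then 1 else 0)
      + (p j - if j = 1 then 1 else 0) * (h : ℝ)) with hd
  have hd0 : ∀ h, HasSum (d h) 0 := by
    intro h
    have h1 : HasSum (fun j : ℕ => if j = 1 then (1 : ℝ) else 0) 1 := hasSum_ite_eq 1 1
    have := (hP.hasSum_one h 1).sub (h1.add ((hp.hasSum_one.sub h1).mul_right (h : ℝ)))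
    simpa using this
  have hdy : ∀ h, ∀ y ∈ Set.Icc (0 : ℝ) 1,
      HasSum (fun j => d h j * y ^ j) (genFun P h y - y - h * (pgf p y - y)) := by
    intro h y hy
    have h1 : HasSum (fun j : ℕ => if j = 1 then y else 0) y := hasSum_ite_eq 1 y
    have := (hP.summable_pow h 1 hy).hasSum.sub
      (h1.add (((hp.summable_pgf hy).hasSum.sub h1).mul_right (h : ℝ)))
    have h2 := this.congr_fun (g := fun j => d h j * y ^ j) fun j => by
      by_cases hj : j = 1
      · subst hj; simp [hd]; ring
      · simp [hd, hj]; ring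
    rwa [← sub_sub, mul_comm _ (h : ℝ)] at h2
  -- `2 ≤ N` keeps the diagonal index `j = 1` out of the tail.
  obtain ⟨N, hN2, hN⟩ : ∃ N, 2 ≤ N ∧ ∑' k, p (k + N) < ε / 4 := by
    have h1 := (tendsto_sum_nat_add p).eventually (gt_mem_nhds (show (0 : ℝ) < ε / 4 by positivity))
    obtain ⟨N, h2, h3⟩ := (h1.and (eventually_ge_atTop 2)).exists
    exact ⟨N, h3, h2⟩
  have hsmall : (fun h => ∑ j ∈ Finset.range N, |d h j|) =o[𝓝 0] fun h : ℝ≥0 => (h : ℝ) :=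
    IsLittleO.fun_sum fun j _ => (hP.infinitesimal j).abs_left
  filter_upwards [isLittleO_iff.1 hsmall (show (0 : ℝ) < ε / 4 by positivity)] with h hh y hy
  have hh0 : (0 : ℝ) ≤ h := h.2
  rw [Real.norm_of_nonneg hh0,
    Real.norm_of_nonneg (Finset.sum_nonneg fun j _ => abs_nonneg (d h j))] at hh
  have hsn : Summable fun j => (d h j)⁻ := (hd0 h).summable.abs.of_nonneg_of_le
    (fun j => negPart_nonneg _) fun j => by
      rw [← posPart_add_negPart]; linarith [posPart_nonneg (d h j)]
  have htail : ∑' j, (d h (j + N))⁻ ≤ ε / 4 * h := by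
    have h1 : ∀ j, (d h (j + N))⁻ ≤ p (j + N) * h := by
      intro j
      rw [negPart_def, sup_le_iff]
      have hj : j + N ≠ 1 := by omega
      refine ⟨?_, mul_nonneg (hp.nonneg _) hh0⟩
      simp only [hd, hj, if_false]
      linarith [hP.nonneg h 1 (j + N)]
    have h2 := (summable_nat_add_iff N).2 hp.hasSum_one.summable
    calc ∑' j, (d h (j + N))⁻ ≤ ∑' j, p (j + N) * h :=
          ((summable_nat_add_iff N).2 hsn).tsum_le_tsum h1 (h2.mul_right _)
      _ = (∑' j, p (j + N)) * h := tsum_mul_right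
      _ ≤ ε / 4 * h := mul_le_mul_of_nonneg_right hN.le hh0
  have hneg : ∑' j, (d h j)⁻ ≤ ε / 2 * h := by
    rw [← hsn.sum_add_tsum_nat_add N]
    have : ∑ j ∈ Finset.range N, (d h j)⁻ ≤ ∑ j ∈ Finset.range N, |d h j| :=
      Finset.sum_le_sum fun j _ => by
        rw [← posPart_add_negPart]; linarith [posPart_nonneg (d h j)]
    linarith
  have habs : ∑' j, |d h j| = 2 * ∑' j, (d h j)⁻ := by
    have := ((hd0 h).add (hsn.hasSum.mul_left 2)).tsum_eq
    rw [zero_add] at this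
    rw [← this]
    refine tsum_congr fun j => ?_
    nth_rewrite 2 [← posPart_sub_negPart (d h j)]
    rw [← posPart_add_negPart]
    ring
  rw [← (hdy h y hy).tsum_eq, ← Real.norm_eq_abs]
  refine (tsum_of_norm_bounded (hd0 h).summable.abs.hasSum fun j => ?_).trans (by linarith)
  rw [norm_mul, Real.norm_eq_abs, norm_pow, Real.norm_of_nonneg hy.1]
  exact mul_le_of_le_one_right (abs_nonneg _) (pow_le_one₀ hy.1 hy.2)

lemma hasDerivWithinAt_genFun (hp : IsSupercritical p) {x : ℝ} (hx : x ∈ Set.Icc (0 : ℝ) 1)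
    {t : ℝ} (ht : 0 ≤ t) :
    HasDerivWithinAt (fun s : ℝ => genFun P s.toNNReal x)
      (pgf p (genFun P t.toNNReal x) - genFun P t.toNNReal x) (Set.Ici t) t := by
  rw [hasDerivWithinAt_iff_isLittleO, isLittleO_iff]
  intro ε hε
  have htend : Tendsto (fun s : ℝ => (s - t).toNNReal) (𝓝[≥] t) (𝓝 0) := by
    have : Continuous fun s : ℝ => (s - t).toNNReal := by fun_prop
    simpa using (this.tendsto t).mono_left nhdsWithin_le_nhds
  filter_upwards [htend.eventually (hP.genFun_infinitesimal hp hε), self_mem_nhdsWithin]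
    with s hs hst
  have hst' : 0 ≤ s - t := sub_nonneg.2 hst
  have h1 : s.toNNReal = (s - t).toNNReal + t.toNNReal := by
    rw [← Real.toNNReal_add hst' ht, sub_add_cancel]
  have h2 := hs _ (hP.genFun_mem t.toNNReal hx)
  rw [Real.coe_toNNReal _ hst', ← hP.genFun_add _ _ hx, ← h1] at h2
  rwa [Real.norm_eq_abs, Real.norm_of_nonneg hst', smul_eq_mul]

/-- A right derivative does not give left continuity. The estimate `genFun_infinitesimal` is uniform
in `y`, hence in the base time, and gives a local Lipschitz bound: `1` from `|f(y) - y| ≤ 1` and `1`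
from `ε = 1`. -/
lemma continuousOn_genFun (hp : IsSupercritical p) {x : ℝ} (hx : x ∈ Set.Icc (0 : ℝ) 1) :
    ContinuousOn (fun s : ℝ => genFun P s.toNNReal x) (Set.Ici 0) := by
  obtain ⟨δ, hδ, hδ'⟩ := Metric.eventually_nhds_iff.1 (hP.genFun_infinitesimal hp one_pos)
  have key : ∀ s t : ℝ, 0 ≤ t → t ≤ s → s - t < δ →
      |genFun P s.toNNReal x - genFun P t.toNNReal x| ≤ 2 * (s - t) := by
    intro s t ht hst hsd
    have hst' : 0 ≤ s - t := sub_nonneg.2 hst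
    have h1 : s.toNNReal = (s - t).toNNReal + t.toNNReal := by
      rw [← Real.toNNReal_add hst' ht, sub_add_cancel]
    have hy := hP.genFun_mem t.toNNReal hx
    have h2 := hδ' (y := (s - t).toNNReal)
      (by rw [NNReal.dist_eq, Real.coe_toNNReal _ hst']; simpa [abs_of_nonneg hst'] using hsd) _ hy
    rw [Real.coe_toNNReal _ hst', ← hP.genFun_add _ _ hx, ← h1] at h2
    set y := genFun P t.toNNReal x
    have h3 : |pgf p y - y| ≤ 1 := by
      have := hp.pgf_mem hy
      rw [abs_le]; constructor <;> linarith [this.1, this.2, hy.1, hy.2]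
    have h4 : |(s - t) * (pgf p y - y)| ≤ s - t := by
      rw [abs_mul, abs_of_nonneg hst']
      exact mul_le_of_le_one_right hst' h3
    have h5 := abs_add_le (genFun P s.toNNReal x - y - (s - t) * (pgf p y - y))
      ((s - t) * (pgf p y - y))
    rw [sub_add_cancel] at h5
    linarith
  rw [Metric.continuousOn_iff]
  intro t ht ε hε
  refine ⟨min δ (ε / 2), by positivity, fun s hs hst => ?_⟩
  rw [Real.dist_eq] at hst ⊢
  have hs1 := hst.trans_le (min_le_left _ _)
  have hs2 := hst.trans_le (min_le_right _ _)
  rcases le_total t s with h | h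
  · rw [abs_of_nonneg (sub_nonneg.2 h)] at hs1 hs2
    linarith [key s t ht h hs1]
  · rw [abs_sub_comm, abs_of_nonneg (sub_nonneg.2 h)] at hs1 hs2
    rw [abs_sub_comm]
    linarith [key t s hs h hs1]

/-- While `F > q`, `F' = f(F) - F ≥ -(F - q)`. The barrier decays at rate `2` rather than `1` so
that the derivative comparison is strict where the curves touch. -/
lemma extinctionRoot_lt_genFun (hp : IsSupercritical p) {x : ℝ}
    (hx : x ∈ Set.Ioo (extinctionRoot p) 1) (t : ℝ≥0) : extinctionRoot p < genFun P t x := by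
  have hx' := hp.Ioo_subset hx
  set q := extinctionRoot p with hq
  have hpos : ∀ s : ℝ, 0 < (x - q) * Real.exp (-2 * s) := fun s =>
    mul_pos (by linarith [hx.1]) (Real.exp_pos _)
  have key := image_le_of_deriv_right_lt_deriv_boundary (a := 0) (b := t)
    (f := fun s : ℝ => -genFun P s.toNNReal x)
    (B := fun s => -(q + (x - q) * Real.exp (-2 * s)))
    (B' := fun s => 2 * ((x - q) * Real.exp (-2 * s)))
    ((hP.continuousOn_genFun hp hx').neg.mono Set.Icc_subset_Ici_self)
    (fun s hs => (hP.hasDerivWithinAt_genFun hp hx' hs.1).neg)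
    (by simp [hP.genFun_zero])
    (fun s => by
      have h := (((hasDerivAt_id s).const_mul (-2)).exp.const_mul (x - q)).const_add q |>.neg
      refine h.congr_deriv ?_
      simp only [id]
      ring)
    (fun s hs h => by
      have h1 : genFun P s.toNNReal x = q + (x - q) * Real.exp (-2 * s) := neg_injective h
      have h2 := hp.pgf_monotoneOn hp.extinctionRoot_mem (hP.genFun_mem s.toNNReal hx')
        (by rw [h1, ← hq]; linarith [hpos s])
      rw [hp.pgf_extinctionRoot, ← hq] at h2
      linarith [hpos s])
    (Set.right_mem_Icc.2 t.2)
  simp only [Real.toNNReal_coe] at key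
  linarith [hpos t]

lemma genFun_lt_one (hp : IsSupercritical p) {x : ℝ} (hx : x ∈ Set.Ico (0 : ℝ) 1) (t : ℝ≥0) :
    genFun P t x < 1 := by
  have hx' := Set.Ico_subset_Icc_self hx
  have hpos : ∀ s : ℝ, 0 < (1 - x) * Real.exp (-2 * s) := fun s =>
    mul_pos (by linarith [hx.2]) (Real.exp_pos _)
  have key := image_le_of_deriv_right_lt_deriv_boundary (a := 0) (b := t)
    (f := fun s : ℝ => genFun P s.toNNReal x)
    (B := fun s => 1 - (1 - x) * Real.exp (-2 * s))
    (B' := fun s => 2 * ((1 - x) * Real.exp (-2 * s)))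
    ((hP.continuousOn_genFun hp hx').mono Set.Icc_subset_Ici_self)
    (fun s hs => hP.hasDerivWithinAt_genFun hp hx' hs.1)
    (by simp [hP.genFun_zero])
    (fun s => by
      have h := (((hasDerivAt_id s).const_mul (-2)).exp.const_mul (1 - x)).const_sub 1
      refine h.congr_deriv ?_
      simp only [id]
      ring)
    (fun s hs h => by
      have h2 := (hp.pgf_mem (hP.genFun_mem s.toNNReal hx')).2
      linarith [hpos s])
    (Set.right_mem_Icc.2 t.2)
  simp only [Real.toNNReal_coe] at key
  linarith [hpos t]

/-- By `x - f(x) ≤ a (1 - x)` with `a = mean p - 1`, the function `e^{-a s} (1 - F_s(x))` is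
nonincreasing. -/
lemma one_sub_genFun_le (hp : IsSupercritical p) {x : ℝ} (hx : x ∈ Set.Icc (0 : ℝ) 1) (t : ℝ≥0) :
    1 - genFun P t x ≤ (1 - x) * Real.exp ((mean p - 1) * t) := by
  set a := mean p - 1 with ha
  have hexp : ∀ s : ℝ, HasDerivAt (fun s => Real.exp (-a * s)) (Real.exp (-a * s) * -a) s :=
    fun s => by simpa using ((hasDerivAt_id s).const_mul (-a)).exp
  have key := image_le_of_deriv_right_le_deriv_boundary (a := 0) (b := t)
    (f := fun s : ℝ => Real.exp (-a * s) * (1 - genFun P s.toNNReal x))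
    (B := fun _ => 1 - x) (B' := fun _ => 0)
    (ContinuousOn.mul (by fun_prop) (continuousOn_const.sub
      ((hP.continuousOn_genFun hp hx).mono Set.Icc_subset_Ici_self)))
    (fun s hs => (hexp s).hasDerivWithinAt.mul
      ((hP.hasDerivWithinAt_genFun hp hx hs.1).const_sub 1))
    (by simp [hP.genFun_zero]) continuousOn_const
    (fun s _ => hasDerivWithinAt_const _ _ _)
    (fun s hs => by
      have h2 := hp.sub_pgf_le (hP.genFun_mem s.toNNReal hx)
      rw [← ha] at h2
      have := mul_le_mul_of_nonneg_left h2 (Real.exp_pos (-a * s)).le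
      linarith)
    (Set.right_mem_Icc.2 t.2)
  simp only [Real.toNNReal_coe] at key
  have h := mul_le_mul_of_nonneg_right key (Real.exp_pos (a * t)).le
  have h3 : Real.exp (-a * t) * Real.exp (a * t) = 1 := by
    rw [← Real.exp_add]; simp
  calc 1 - genFun P t x = (1 - genFun P t x) * (Real.exp (-a * t) * Real.exp (a * t)) := by
        rw [h3, mul_one]
    _ = Real.exp (-a * t) * (1 - genFun P t x) * Real.exp (a * t) := by ring
    _ ≤ _ := h

/-- Bernoulli gives `1 - F^i ≤ i (1 - F)`. Dividing by `1 - x` and letting `x ↑ 1` bounds the mean;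
only finite partial sums are involved, so no interchange of limits arises. -/
lemma sum_range_mean_le (hp : IsSupercritical p) (t : ℝ≥0) (i n : ℕ) :
    ∑ j ∈ Finset.range n, P t i j * j ≤ i * Real.exp ((mean p - 1) * t) := by
  have hlt : ∀ x ∈ Set.Ioo (0 : ℝ) 1, ∑ j ∈ Finset.range n,
      P t i j * ∑ l ∈ Finset.range j, x ^ l ≤ i * Real.exp ((mean p - 1) * t) := by
    intro x hx
    have hx' := Set.Ioo_subset_Icc_self hx
    have h1x : 0 < 1 - x := by linarith [hx.2]
    have hs := (hP.hasSum_one t i).sub (hP.summable_pow t i hx').hasSum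
    have h1 := sum_le_hasSum (Finset.range n) (fun j _ => by
      have := mul_le_of_le_one_right (hP.nonneg t i j) (pow_le_one₀ (n := j) hx'.1 hx'.2)
      linarith) hs
    rw [hP.branching t i x hx'] at h1
    have h2 := one_add_mul_le_pow (a := genFun P t x - 1)
      (by linarith [(hP.genFun_mem t hx').1]) i
    rw [add_sub_cancel] at h2
    have h3 := mul_le_mul_of_nonneg_left (hP.one_sub_genFun_le hp hx' t) (Nat.cast_nonneg (α := ℝ) i)
    have h4 : (∑ j ∈ Finset.range n, P t i j * ∑ l ∈ Finset.range j, x ^ l) * (1 - x)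
        = ∑ j ∈ Finset.range n, (P t i j - P t i j * x ^ j) := by
      rw [Finset.sum_mul]
      refine Finset.sum_congr rfl fun j _ => ?_
      rw [mul_assoc, geom_sum_mul_neg]; ring
    refine le_of_mul_le_mul_right ?_ h1x
    rw [h4]
    change _ ≤ 1 - genFun P t x ^ i at h1
    linarith
  have hcont : Continuous fun x : ℝ => ∑ j ∈ Finset.range n,
      P t i j * ∑ l ∈ Finset.range j, x ^ l := by fun_prop
  have := le_of_tendsto ((hcont.tendsto 1).mono_left (nhdsWithin_le_nhds (s := Set.Iio 1)))
    (eventually_of_mem (Ioo_mem_nhdsLT zero_lt_one) hlt)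
  simpa using this

/-- The derivative of `log (1 - z) - ∫_y^z excess` is `-(mean p - 1) / (z - f(z))`; along the
backward equation it contributes exactly `mean p - 1`. -/
lemma log_one_sub_genFun (hp : IsSupercritical p) {x y : ℝ}
    (hx : x ∈ Set.Ioo (extinctionRoot p) 1) (hy : y ∈ Set.Ioo (extinctionRoot p) 1) (t : ℝ≥0) :
    Real.log (1 - genFun P t x) - (mean p - 1) * t - ∫ s in y..genFun P t x, excess p s
      = Real.log (1 - x) - ∫ s in y..x, excess p s := by
  have hx' := hp.Ioo_subset hx
  have hmem : ∀ s, genFun P s x ∈ Set.Ioo (extinctionRoot p) 1 := fun s =>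
    ⟨hP.extinctionRoot_lt_genFun hp hx s, hP.genFun_lt_one hp ⟨hx'.1, hx.2⟩ s⟩
  have hC : ∀ z ∈ Set.Ioo (extinctionRoot p) 1,
      HasDerivAt (fun z => ∫ s in y..z, excess p s) (excess p z) z := fun z hz =>
    intervalIntegral.integral_hasDerivAt_right
      ((hp.continuousOn_excess.mono (Set.OrdConnected.uIcc_subset Set.ordConnected_Ioo hy hz)).intervalIntegrable)
      (hp.continuousOn_excess.stronglyMeasurableAtFilter isOpen_Ioo z hz)
      (hp.continuousOn_excess.continuousAt (isOpen_Ioo.mem_nhds hz))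
  have hG : ∀ z ∈ Set.Ioo (extinctionRoot p) 1, HasDerivAt
      (fun z => Real.log (1 - z) - ∫ s in y..z, excess p s) (-1 / (1 - z) - excess p z) z :=
    fun z hz => (((hasDerivAt_id z).const_sub 1).log (by simpa [sub_eq_zero] using hz.2.ne')).sub (hC z hz)
  have hcont : ContinuousOn (fun z => Real.log (1 - z) - ∫ s in y..z, excess p s)
      (Set.Ioo (extinctionRoot p) 1) := fun z hz => (hG z hz).continuousAt.continuousWithinAt
  have key := constant_of_has_deriv_right_zero (a := 0) (b := t)
    (f := fun s : ℝ => (Real.log (1 - genFun P s.toNNReal x)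
      - ∫ r in y..genFun P s.toNNReal x, excess p r) - (mean p - 1) * s)
    ((hcont.comp ((hP.continuousOn_genFun hp hx').mono Set.Icc_subset_Ici_self)
      fun s _ => hmem _).sub (by fun_prop))
    (fun s hs => by
      have h := ((hG _ (hmem s.toNNReal)).comp_hasDerivWithinAt s
        (hP.hasDerivWithinAt_genFun hp hx' hs.1)).sub
        ((hasDerivAt_id s).const_mul (mean p - 1)).hasDerivWithinAt
      refine h.congr_deriv ?_
      have h1 := (hp.sub_pgf_pos (hmem s.toNNReal)).ne'
      have h2 : 1 - genFun P s.toNNReal x ≠ 0 := by linarith [(hmem s.toNNReal).2]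
      rw [excess]
      field_simp
      ring)
    t (Set.right_mem_Icc.2 t.2)
  simp only [Real.toNNReal_coe, Real.toNNReal_zero, hP.genFun_zero, mul_zero, sub_zero] at key
  linarith

end IsBranchingSemigroup

/-! ### Upcrossings on fine grids and convergence in continuous time -/

lemma tendsto_ceil_div (t : ℝ≥0) :
    Tendsto (fun m : ℕ => (⌈t * (m + 1)⌉₊ : ℝ≥0) / (m + 1)) atTop (𝓝[≥] t) := by
  have hpos : ∀ m : ℕ, (0 : ℝ≥0) < m + 1 := fun m => by positivity
  have hge : ∀ m : ℕ, t ≤ (⌈t * (m + 1)⌉₊ : ℝ≥0) / (m + 1) := fun m => by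
    rw [le_div_iff₀ (hpos m)]
    exact Nat.le_ceil _
  refine tendsto_nhdsWithin_iff.2 ⟨?_, Eventually.of_forall hge⟩
  have hlim : Tendsto (fun m : ℕ => t + 1 / ((m : ℝ≥0) + 1)) atTop (𝓝 t) := by
    have := tendsto_one_div_add_atTop_nhds_zero_nat (𝕜 := ℝ≥0)
    simpa using this.const_add t
  refine tendsto_of_tendsto_of_tendsto_of_le_of_le tendsto_const_nhds hlim hge fun m => ?_
  have : t + 1 / ((m : ℝ≥0) + 1) = (t * (m + 1) + 1) / (m + 1) := by
    field_simp [(hpos m).ne']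
  simp only [this]
  exact div_le_div_of_nonneg_right (Nat.ceil_lt_add_one (by positivity)).le (hpos m).le

/-- Each further visit below `a` and then above `b` persists, by right continuity, at the grid
points just to the right. It adds an upcrossing on all fine grids, before a time `T` independent of
the mesh. -/
lemma eventually_le_upcrossingsBefore {Ω : Type*} {Y : ℝ≥0 → Ω → ℝ} {ω : Ω}
    (hY : ∀ t, ContinuousWithinAt (fun u => Y u ω) (Set.Ici t) t) {a b : ℝ} (hab : a < b)
    (ha : ∃ᶠ t in atTop, Y t ω < a) (hb : ∃ᶠ t in atTop, b < Y t ω) (K : ℕ) :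
    ∃ T : ℝ≥0, ∀ᶠ m : ℕ in atTop, ∃ N : ℕ, (N : ℝ≥0) / (m + 1) ≤ T ∧
      K ≤ upcrossingsBefore a b (fun k : ℕ => Y (k / (m + 1))) N ω := by
  induction K with
  | zero => exact ⟨0, Eventually.of_forall fun m => ⟨0, by simp, Nat.zero_le _⟩⟩
  | succ K ih =>
    obtain ⟨T, hT⟩ := ih
    obtain ⟨t₁, h₁, hT₁⟩ := (ha.and_eventually (eventually_gt_atTop T)).exists
    obtain ⟨t₂, h₂, hT₂⟩ := (hb.and_eventually (eventually_ge_atTop t₁)).exists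
    -- One unit covers the rounding up to the grid, the other the extra grid step needed to complete
    -- the upcrossing before the horizon.
    refine ⟨t₂ + 2, ?_⟩
    filter_upwards [hT, (tendsto_ceil_div t₁).eventually ((hY t₁).eventually (gt_mem_nhds h₁)),
      (tendsto_ceil_div t₂).eventually ((hY t₂).eventually (lt_mem_nhds h₂))] with m hm hm₁ hm₂
    obtain ⟨N, hN, hK⟩ := hm
    have hpos : (0 : ℝ≥0) < m + 1 := by positivity
    refine ⟨⌈t₂ * (m + 1)⌉₊ + 1, ?_, Nat.succ_le_of_lt (hK.trans_lt
      (upcrossingsBefore_lt_of_exists_upcrossing hab (N₁ := ⌈t₁ * (m + 1)⌉₊) ?_ hm₁ ?_ hm₂))⟩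
    · rw [div_le_iff₀ hpos]
      push_cast
      have h3 := (Nat.ceil_lt_add_one (show 0 ≤ t₂ * (m + 1 : ℝ≥0) by positivity)).le
      calc (⌈t₂ * (m + 1 : ℝ≥0)⌉₊ : ℝ≥0) + 1 ≤ t₂ * (m + 1) + 1 + 1 := by gcongr
        _ ≤ t₂ * (m + 1) + 2 * (m + 1) := by
          rw [add_assoc, one_add_one_eq_two]
          gcongr
          exact le_mul_of_one_le_right (by positivity) le_add_self
        _ = (t₂ + 2) * (m + 1) := by ring
    · have h3 := (hN.trans_lt hT₁).trans_le
        ((le_div_iff₀ hpos).2 (Nat.le_ceil (t₁ * (m + 1 : ℝ≥0))))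
      rw [div_lt_div_iff_of_pos_right hpos] at h3
      exact_mod_cast h3.le
    · gcongr

lemma tendsto_of_tendsto_natCast {f : ℝ≥0 → ℝ} {w : ℝ}
    (hw : Tendsto (fun n : ℕ => f n) atTop (𝓝 w))
    (h : ∀ a b : ℚ, a < b → ¬ ((∃ᶠ t in atTop, f t < a) ∧ ∃ᶠ t in atTop, (b : ℝ) < f t)) :
    Tendsto f atTop (𝓝 w) := by
  have hcast := tendsto_natCast_atTop_atTop (R := ℝ≥0)
  refine tendsto_order.2 ⟨fun c hc => ?_, fun c hc => ?_⟩
  · by_contra hn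
    obtain ⟨a, hca, haw⟩ := exists_rat_btwn hc
    obtain ⟨b, hab, hbw⟩ := exists_rat_btwn haw
    refine h a b (by exact_mod_cast hab) ⟨?_, ?_⟩
    · exact (not_eventually.1 hn).mono fun t ht => (not_lt.1 ht).trans_lt hca
    · exact hcast.frequently (hw.eventually (lt_mem_nhds hbw)).frequently
  · by_contra hn
    obtain ⟨b, hwb, hbc⟩ := exists_rat_btwn hc
    obtain ⟨a, hwa, hab⟩ := exists_rat_btwn hwb
    refine h a b (by exact_mod_cast hab) ⟨?_, ?_⟩
    · exact hcast.frequently (hw.eventually (gt_mem_nhds hwa)).frequently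
    · exact (not_eventually.1 hn).mono fun t ht => hbc.trans_le (not_lt.1 ht)

/-- A nonpositive right-continuous process in continuous time whose restriction to each of the
grids `ℕ / (m + 1)` is a submartingale does not oscillate. -/
lemma ae_not_oscillating {Ω : Type*} [MeasurableSpace Ω] {μ : Measure Ω} [IsProbabilityMeasure μ]
    {Y : ℝ≥0 → Ω → ℝ} (hY : ∀ t ω, Y t ω ≤ 0)
    (hcont : ∀ᵐ ω ∂μ, ∀ t, ContinuousWithinAt (fun u => Y u ω) (Set.Ici t) t)
    (ℱ : ℕ → Filtration ℕ ‹MeasurableSpace Ω›)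
    (hsub : ∀ m : ℕ, Submartingale (fun k : ℕ => Y (k / (m + 1))) (ℱ m) μ) :
    ∀ᵐ ω ∂μ, ∀ a b : ℚ, a < b →
      ¬ ((∃ᶠ t in atTop, Y t ω < a) ∧ ∃ᶠ t in atTop, (b : ℝ) < Y t ω) := by
  rw [ae_all_iff]; intro a
  rw [ae_all_iff]; intro b
  by_cases hab : a < b
  swap
  · exact Eventually.of_forall fun ω h => absurd h hab
  have hab' : (a : ℝ) < b := by exact_mod_cast hab
  set U : ℕ → Ω → ℝ≥0∞ := fun m ω => upcrossings a b (fun k : ℕ => Y (k / (m + 1))) ω with hU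
  have hUm : ∀ m, Measurable (U m) := fun m =>
    (hsub m).stronglyAdapted.measurable_upcrossings hab'
  -- Since `Y ≤ 0`, the positive part of `Y - a` is at most `|a|`, so Doob's bound is uniform in the
  -- horizon and in the mesh. Fatou then makes the lower limit over meshes finite almost surely.
  have hUle : ∀ m, ∫⁻ ω, U m ω ∂μ ≤ ENNReal.ofReal |(a : ℝ)| / ENNReal.ofReal (b - a) := by
    intro m
    rw [ENNReal.le_div_iff_mul_le (Or.inl (by simpa using hab')) (Or.inl ENNReal.ofReal_ne_top),
      mul_comm]
    refine ((hsub m).mul_lintegral_upcrossings_le_lintegral_pos_part a b).trans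
      (iSup_le fun N => ?_)
    calc ∫⁻ ω, ENNReal.ofReal ((Y (N / (m + 1)) ω - a)⁺) ∂μ
        ≤ ∫⁻ _, ENNReal.ofReal |(a : ℝ)| ∂μ := by
          refine lintegral_mono fun ω => ENNReal.ofReal_le_ofReal ?_
          rw [posPart_def, sup_le_iff]
          exact ⟨by linarith [hY (N / (m + 1)) ω, neg_abs_le (a : ℝ)], abs_nonneg _⟩
      _ = _ := by simp
  have hfin : ∫⁻ ω, liminf (fun m => U m ω) atTop ∂μ ≠ ⊤ := by
    refine ne_top_of_le_ne_top (b := ENNReal.ofReal |(a : ℝ)| / ENNReal.ofReal (b - a)) ?_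
      ((lintegral_liminf_le hUm).trans (liminf_le_of_le (by isBoundedDefault) fun c hc => ?_))
    · exact ENNReal.div_ne_top ENNReal.ofReal_ne_top (by simpa using hab')
    · obtain ⟨m, hm⟩ := hc.exists
      exact hm.trans (hUle m)
  filter_upwards [ae_lt_top (Measurable.liminf hUm) hfin, hcont] with ω hω hc _ hosc
  refine hω.ne (ENNReal.eq_top_of_forall_nnreal_le fun r => ?_)
  obtain ⟨K, hK⟩ := exists_nat_ge r
  obtain ⟨T, hT⟩ := eventually_le_upcrossingsBefore hc hab' hosc.1 hosc.2 K
  refine le_liminf_of_le (by isBoundedDefault) (hT.mono fun m hm => ?_)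
  obtain ⟨N, -, hN⟩ := hm
  calc (r : ℝ≥0∞) ≤ (K : ℝ≥0∞) := by exact_mod_cast hK
    _ ≤ (upcrossingsBefore a b (fun k : ℕ => Y (k / (m + 1))) N ω : ℝ≥0∞) := by exact_mod_cast hN
    _ ≤ U m ω := le_iSup (fun N => (upcrossingsBefore a b (fun k : ℕ => Y (k / (m + 1))) N ω : ℝ≥0∞)) N

/-! ### Almost sure convergence of the normalized population -/

/-- The σ-algebras `σ(Z_u : u ≤ k / (m + 1))`. -/
def gridFiltration {Ω : Type*} [MeasurableSpace Ω] {Z : ℝ≥0 → Ω → ℕ} (hZ : ∀ t, Measurable (Z t))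
    (m : ℕ) : Filtration ℕ ‹MeasurableSpace Ω› where
  seq k := ⨆ u : Set.Iic ((k : ℝ≥0) / (m + 1)), MeasurableSpace.comap (Z u) ⊤
  mono' i j hij := iSup_le fun u => le_iSup_of_le
    (⟨u, Set.mem_Iic.2 ((Set.mem_Iic.1 u.2).trans
      (div_le_div_of_nonneg_right (by exact_mod_cast hij) (by positivity)))⟩ : Set.Iic ((j : ℝ≥0) / (m + 1))) le_rfl
  le' k := iSup_le fun u => (hZ u).comap_le

lemma gridFiltration_apply {Ω : Type*} [MeasurableSpace Ω] {Z : ℝ≥0 → Ω → ℕ}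
    (hZ : ∀ t, Measurable (Z t)) (m k : ℕ) : gridFiltration hZ m k
      = ⨆ u : Set.Iic ((k : ℝ≥0) / (m + 1)), MeasurableSpace.comap (Z u) ⊤ := rfl

namespace IsBranchingProcess

variable {Ω : Type*} [MeasurableSpace Ω] {μ : Measure Ω} [IsProbabilityMeasure μ] {p : ℕ → ℝ}
  {Z : ℝ≥0 → Ω → ℕ} {P : ℝ≥0 → ℕ → ℕ → ℝ}

lemma measureReal_eq (hZ : IsBranchingProcess p Z μ)
    (hmarkov : ∀ (s t : ℝ≥0) (i j : ℕ) (A : Set Ω),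
      MeasurableSet[⨆ u : Set.Iic s, MeasurableSpace.comap (Z u) ⊤] A →
      μ.real (A ∩ {ω | Z s ω = i} ∩ {ω | Z (s + t) ω = j})
        = μ.real (A ∩ {ω | Z s ω = i}) * P t i j) (t : ℝ≥0) (j : ℕ) :
    μ.real {ω | Z t ω = j} = P t 1 j := by
  have h := hmarkov 0 t 1 j Set.univ MeasurableSet.univ
  rw [Set.univ_inter, zero_add] at h
  have h1 : {ω | Z 0 ω = 1} =ᵐ[μ] Set.univ := eventuallyEq_univ.2 hZ.start
  have h2 := measureReal_congr (h1.inter (ae_eq_refl {ω | Z t ω = j}))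
  rw [Set.univ_inter] at h2
  rw [← h2]
  refine h.trans ?_
  rw [measureReal_congr h1, probReal_univ, one_mul]

omit [IsProbabilityMeasure μ] in
lemma lintegral_comp (hZ : ∀ t, Measurable (Z t)) (t : ℝ≥0) (A : Set Ω) (g : ℕ → ℝ≥0∞) :
    ∫⁻ ω in A, g (Z t ω) ∂μ = ∑' j, g j * μ (A ∩ {ω | Z t ω = j}) := by
  rw [← lintegral_map (measurable_of_countable g) (hZ t), lintegral_countable']
  refine tsum_congr fun j => ?_
  rw [Measure.map_apply (hZ t) (measurableSet_singleton j),
    Measure.restrict_apply (hZ t (measurableSet_singleton j)), Set.inter_comm]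
  rfl

lemma integral_pow (hZ : IsBranchingProcess p Z μ)
    (hlaw : ∀ t j, μ.real {ω | Z t ω = j} = P t 1 j) (t : ℝ≥0) {x : ℝ}
    (hx : x ∈ Set.Icc (0 : ℝ) 1) : ∫ ω, x ^ Z t ω ∂μ = genFun P t x := by
  have hmap : ∫ ω, x ^ Z t ω ∂μ = ∫ n, x ^ n ∂(μ.map (Z t)) :=
    (integral_map (hZ.measurable t).aemeasurable
      (measurable_of_countable fun n : ℕ => x ^ n).aestronglyMeasurable).symm
  have : IsProbabilityMeasure (μ.map (Z t)) :=
    Measure.isProbabilityMeasure_map (hZ.measurable t).aemeasurable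
  rw [hmap, integral_countable]
  · refine tsum_congr fun j => ?_
    rw [map_measureReal_apply (hZ.measurable t) (measurableSet_singleton j), smul_eq_mul, ← hlaw]
    rfl
  · refine Integrable.of_bound
      (measurable_of_countable fun n : ℕ => x ^ n).aestronglyMeasurable 1
      (Eventually.of_forall fun n => ?_)
    rw [norm_pow, Real.norm_of_nonneg hx.1]
    exact pow_le_one₀ hx.1 hx.2

/-- Conditioning on the value of `Z s` reduces this to the mean bound of the semigroup. The
inequality suffices: it makes `Z_t e^{-(m₁ - 1) t}` a supermartingale. -/
lemma lintegral_le (hp : IsSupercritical p) (hZ : IsBranchingProcess p Z μ)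
    (hP : IsBranchingSemigroup p P)
    (hmarkov : ∀ (s t : ℝ≥0) (i j : ℕ) (A : Set Ω),
      MeasurableSet[⨆ u : Set.Iic s, MeasurableSpace.comap (Z u) ⊤] A →
      μ.real (A ∩ {ω | Z s ω = i} ∩ {ω | Z (s + t) ω = j})
        = μ.real (A ∩ {ω | Z s ω = i}) * P t i j) (s t : ℝ≥0) {A : Set Ω}
    (hA : MeasurableSet[⨆ u : Set.Iic s, MeasurableSpace.comap (Z u) ⊤] A) :
    ∫⁻ ω in A, (Z (s + t) ω : ℝ≥0∞) ∂μ
      ≤ ENNReal.ofReal (Real.exp ((mean p - 1) * t)) * ∫⁻ ω in A, (Z s ω : ℝ≥0∞) ∂μ := by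
  have hA' : MeasurableSet A :=
    (iSup_le fun u : Set.Iic s => (hZ.measurable u).comap_le :
      (⨆ u : Set.Iic s, MeasurableSpace.comap (Z u) ⊤) ≤ ‹MeasurableSpace Ω›) A hA
  have hset : ∀ u i, MeasurableSet {ω | Z u ω = i} := fun u i =>
    hZ.measurable u (measurableSet_singleton i)
  have hmk : ∀ i j, μ (A ∩ {ω | Z s ω = i} ∩ {ω | Z (s + t) ω = j})
      = μ (A ∩ {ω | Z s ω = i}) * ENNReal.ofReal (P t i j) := by
    intro i j
    rw [← ofReal_measureReal, hmarkov s t i j A hA, ENNReal.ofReal_mul measureReal_nonneg,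
      ofReal_measureReal]
  have hmean : ∀ i : ℕ, ∑' j : ℕ, (j : ℝ≥0∞) * ENNReal.ofReal (P t i j)
      ≤ ENNReal.ofReal (Real.exp ((mean p - 1) * t)) * i := by
    intro i
    rw [ENNReal.tsum_eq_iSup_nat]
    refine iSup_le fun n => ?_
    have h := ENNReal.ofReal_le_ofReal (hP.sum_range_mean_le hp t i n)
    rw [ENNReal.ofReal_sum_of_nonneg fun j _ => mul_nonneg (hP.nonneg t i j) j.cast_nonneg,
      mul_comm (i : ℝ), ENNReal.ofReal_mul (Real.exp_pos _).le, ENNReal.ofReal_natCast] at h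
    refine le_trans (le_of_eq (Finset.sum_congr rfl fun j _ => ?_)) h
    rw [ENNReal.ofReal_mul (hP.nonneg t i j), ENNReal.ofReal_natCast, mul_comm]
  have hsplit : ∀ j, μ (A ∩ {ω | Z (s + t) ω = j})
      = ∑' i, μ (A ∩ {ω | Z s ω = i} ∩ {ω | Z (s + t) ω = j}) := by
    intro j
    rw [← measure_iUnion]
    · congr 1; ext ω; simp
    · intro i i' hii'
      refine Set.disjoint_left.2 fun ω h h' => hii' ?_
      rw [← h.1.2, ← h'.1.2]
    · exact fun i => (hA'.inter (hset s i)).inter (hset _ j)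
  rw [lintegral_comp hZ.measurable (s + t) A fun j => (j : ℝ≥0∞),
    lintegral_comp hZ.measurable s A fun j => (j : ℝ≥0∞), ← ENNReal.tsum_mul_left]
  simp_rw [hsplit, hmk, ← ENNReal.tsum_mul_left]
  rw [ENNReal.tsum_comm]
  refine ENNReal.tsum_le_tsum fun i => ?_
  calc ∑' j : ℕ, (j : ℝ≥0∞) * (μ (A ∩ {ω | Z s ω = i}) * ENNReal.ofReal (P t i j))
      = μ (A ∩ {ω | Z s ω = i}) * ∑' j : ℕ, (j : ℝ≥0∞) * ENNReal.ofReal (P t i j) := by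
        rw [← ENNReal.tsum_mul_left]
        exact tsum_congr fun j => by ring
    _ ≤ μ (A ∩ {ω | Z s ω = i}) * (ENNReal.ofReal (Real.exp ((mean p - 1) * t)) * i) := by
        gcongr; exact hmean i
    _ = _ := by ring

/-- The normalized population size `Z_t e^{-(m₁ - 1) t}` converges almost surely. -/
theorem ae_exists_tendsto (hp : IsSupercritical p) (hZ : IsBranchingProcess p Z μ) :
    ∀ᵐ ω ∂μ, ∃ w : ℝ, Tendsto
      (fun t : ℝ≥0 => (Z t ω : ℝ) / Real.exp ((mean p - 1) * t)) atTop (𝓝 w) := by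
  obtain ⟨P, hP, hmarkov⟩ := hZ.markov
  set a := mean p - 1 with ha
  set Y : ℝ≥0 → Ω → ℝ := fun t ω => -((Z t ω : ℝ) / Real.exp (a * t)) with hYdef
  have hYm : ∀ t, Measurable (Y t) := fun t =>
    (measurable_of_countable fun n : ℕ => -((n : ℝ) / Real.exp (a * t))).comp (hZ.measurable t)
  have hle := fun s t A hA => lintegral_le (A := A) hp hZ hP hmarkov s t hA
  have hnorm : ∀ t (A : Set Ω), ∫⁻ ω in A, ‖Y t ω‖ₑ ∂μ
      = ENNReal.ofReal (Real.exp (-(a * t))) * ∫⁻ ω in A, (Z t ω : ℝ≥0∞) ∂μ := by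
    intro t A
    rw [← lintegral_const_mul' _ _ ENNReal.ofReal_ne_top]
    refine lintegral_congr fun ω => ?_
    simp only [hYdef]
    rw [enorm_neg, Real.enorm_of_nonneg (by positivity), div_eq_mul_inv, ← Real.exp_neg, mul_comm,
      ENNReal.ofReal_mul (Real.exp_pos _).le, ENNReal.ofReal_natCast]
  have hmono : ∀ s t : ℝ≥0, ∀ A,
      MeasurableSet[⨆ u : Set.Iic s, MeasurableSpace.comap (Z u) ⊤] A →
      ∫⁻ ω in A, ‖Y (s + t) ω‖ₑ ∂μ ≤ ∫⁻ ω in A, ‖Y s ω‖ₑ ∂μ := by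
    intro s t A hA
    rw [hnorm, hnorm]
    refine (mul_le_mul_right (hle s t A hA) _).trans (le_of_eq ?_)
    rw [← mul_assoc, ← ENNReal.ofReal_mul (Real.exp_pos _).le, ← Real.exp_add]
    congr 3
    push_cast; ring
  have hone : ∀ t, ∫⁻ ω, ‖Y t ω‖ₑ ∂μ ≤ 1 := by
    intro t
    have h := hmono 0 t Set.univ MeasurableSet.univ
    rw [zero_add, setLIntegral_univ, setLIntegral_univ] at h
    refine h.trans (le_of_eq ?_)
    rw [lintegral_congr_ae (g := fun _ => 1), lintegral_one, measure_univ]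
    filter_upwards [hZ.start] with ω hω
    simp [hYdef, hω]
  have hint : ∀ t, Integrable (Y t) μ := fun t =>
    ⟨(hYm t).aestronglyMeasurable, (hone t).trans_lt ENNReal.one_lt_top⟩
  have hY0 : ∀ t ω, Y t ω ≤ 0 := fun t ω => neg_nonpos.2 (by positivity)
  have hintneg : ∀ t (A : Set Ω), ∫ ω in A, Y t ω ∂μ = -(∫⁻ ω in A, ‖Y t ω‖ₑ ∂μ).toReal := by
    intro t A
    rw [← integral_norm_eq_lintegral_enorm (hYm t).aestronglyMeasurable, ← integral_neg]
    refine integral_congr_ae (Eventually.of_forall fun ω => ?_)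
    simp only [Real.norm_of_nonpos (hY0 t ω), neg_neg]
  have hsub : ∀ m : ℕ, Submartingale (fun k : ℕ => Y (k / (m + 1)))
      (gridFiltration hZ.measurable m) μ := by
    intro m
    refine submartingale_of_setIntegral_le_succ (fun k => ?_) (fun k => hint _) fun k A hA => ?_
    · have h1 : Measurable[gridFiltration hZ.measurable m k] (Z (k / (m + 1))) :=
        measurable_iff_comap_le.2 (gridFiltration_apply hZ.measurable m k ▸ le_iSup_of_le
          (⟨_, Set.self_mem_Iic⟩ : Set.Iic ((k : ℝ≥0) / (m + 1))) le_rfl)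
      exact Measurable.stronglyMeasurable
        ((measurable_of_countable fun n : ℕ => -((n : ℝ) / Real.exp (a * (k / (m + 1) : ℝ≥0)))).comp h1)
    · rw [gridFiltration_apply] at hA
      rw [hintneg, hintneg, neg_le_neg_iff]
      have h1 : ((k + 1 : ℕ) : ℝ≥0) / (m + 1) = k / (m + 1) + 1 / (m + 1) := by
        push_cast; rw [add_div]
      rw [h1]
      refine ENNReal.toReal_mono ?_ (hmono _ _ A hA)
      exact ne_top_of_le_ne_top ENNReal.one_ne_top ((setLIntegral_le_lintegral _ _).trans (hone _))
  have hcont : ∀ᵐ ω ∂μ, ∀ t, ContinuousWithinAt (fun u => Y u ω) (Set.Ici t) t := by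
    filter_upwards [hZ.rightContinuous] with ω hω t
    have h1 : ContinuousWithinAt (fun u => (Z u ω : ℝ)) (Set.Ici t) t :=
      (continuous_of_discreteTopology (f := fun n : ℕ => (n : ℝ))).continuousAt.comp_continuousWithinAt
        (hω t)
    exact (h1.div (Continuous.continuousWithinAt (by fun_prop)) (Real.exp_pos _).ne').neg
  have hlim := (hsub 0).exists_ae_tendsto_of_bdd (R := 1) fun k => by
    rw [eLpNorm_one_eq_lintegral_enorm]; exact hone _
  filter_upwards [hlim, ae_not_oscillating hY0 hcont _ hsub] with ω ⟨w, hw⟩ hosc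
  refine ⟨-w, ?_⟩
  have := (tendsto_of_tendsto_natCast (f := fun t => Y t ω) (by simpa using hw) hosc).neg
  simpa [hYdef] using this

end IsBranchingProcess

/-! ### The Laplace transform of the limit and the rate of `1 - z_n` -/

section Laplace

variable {Ω : Type*} [MeasurableSpace Ω] {μ : Measure Ω} [IsProbabilityMeasure μ] {W : Ω → ℝ}

lemma integrable_exp_neg_mul (hW : AEMeasurable W μ) (hW0 : ∀ᵐ ω ∂μ, 0 ≤ W ω) {ρ : ℝ}
    (hρ : 0 ≤ ρ) : Integrable (fun ω => Real.exp (-ρ * W ω)) μ := by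
  refine Integrable.of_bound (by fun_prop) 1 ?_
  filter_upwards [hW0] with ω hω
  rw [Real.norm_of_nonneg (Real.exp_pos _).le]
  exact Real.exp_le_one_iff.2 (by nlinarith)

lemma laplace_le_one (hW : AEMeasurable W μ) (hW0 : ∀ᵐ ω ∂μ, 0 ≤ W ω) {ρ : ℝ} (hρ : 0 ≤ ρ) :
    laplace μ W ρ ≤ 1 := by
  calc laplace μ W ρ ≤ ∫ _, (1 : ℝ) ∂μ := by
        refine integral_mono_ae (integrable_exp_neg_mul hW hW0 hρ) (integrable_const _) ?_
        filter_upwards [hW0] with ω hω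
        exact Real.exp_le_one_iff.2 (by nlinarith)
    _ = 1 := by simp

/-- For `w > 0`, `e^{-ρ w}` is strictly decreasing in `ρ`, so equal expectations leave only `W = 0`.
-/
lemma ae_eq_zero_of_laplace_le (hW : AEMeasurable W μ) (hW0 : ∀ᵐ ω ∂μ, 0 ≤ W ω) {ρ σ : ℝ}
    (hρ : 0 ≤ ρ) (hσ : ρ < σ) (h : laplace μ W ρ ≤ laplace μ W σ) : ∀ᵐ ω ∂μ, W ω = 0 := by
  have hi := integrable_exp_neg_mul hW hW0 hρ
  have hi' := integrable_exp_neg_mul hW hW0 (hρ.trans hσ.le)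
  have hnn : 0 ≤ᵐ[μ] fun ω => Real.exp (-ρ * W ω) - Real.exp (-σ * W ω) := by
    filter_upwards [hW0] with ω hω
    exact sub_nonneg.2 (Real.exp_le_exp.2 (by nlinarith))
  have hz : ∫ ω, (Real.exp (-ρ * W ω) - Real.exp (-σ * W ω)) ∂μ = 0 := by
    refine le_antisymm ?_ (integral_nonneg_of_ae hnn)
    rw [integral_sub hi hi']
    exact sub_nonpos.2 h
  filter_upwards [(integral_eq_zero_iff_of_nonneg_ae hnn (hi.sub hi')).1 hz] with ω hω
  have h1 : -ρ * W ω = -σ * W ω := Real.exp_injective (sub_eq_zero.1 hω)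
  have h2 : (σ - ρ) * W ω = 0 := by linarith
  exact (mul_eq_zero.1 h2).resolve_left (by linarith)

lemma laplace_eq_one (hW : ∀ᵐ ω ∂μ, W ω = 0) (ρ : ℝ) : laplace μ W ρ = 1 := by
  rw [laplace, integral_congr_ae (g := fun _ => 1), integral_const, probReal_univ, one_smul]
  filter_upwards [hW] with ω hω
  simp [hω]

end Laplace

section Rate

variable {a ρ : ℝ}

lemma tendsto_exp_neg_mul_natCast (ha : 0 < a) :
    Tendsto (fun n : ℕ => Real.exp (-(a * n))) atTop (𝓝 0) :=
  Real.tendsto_exp_neg_atTop_nhds_zero.comp (tendsto_natCast_atTop_atTop.const_mul_atTop ha)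

lemma tendsto_exp_neg_mul_exp (ha : 0 < a) :
    Tendsto (fun n : ℕ => Real.exp (-ρ * Real.exp (-(a * n)))) atTop (𝓝 1) := by
  have := (Real.continuous_exp.tendsto _).comp ((tendsto_exp_neg_mul_natCast ha).const_mul (-ρ))
  simpa [Function.comp_def] using this

lemma tendsto_one_sub_mul_exp (ha : 0 < a) :
    Tendsto (fun n : ℕ => (1 - Real.exp (-ρ * Real.exp (-(a * n)))) * Real.exp (a * n))
      atTop (𝓝 ρ) := by
  have hd : HasDerivAt (fun x : ℝ => 1 - Real.exp (-ρ * x)) ρ 0 := by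
    have := (((hasDerivAt_id (0 : ℝ)).const_mul (-ρ)).exp).const_sub 1
    simpa using this
  have h := (hasDerivAt_iff_tendsto_slope.1 hd).comp (tendsto_nhdsWithin_iff.2
    ⟨tendsto_exp_neg_mul_natCast ha, Eventually.of_forall fun n => (Real.exp_pos _).ne'⟩)
  refine h.congr fun n => ?_
  simp [slope_def_field, Real.exp_neg]

end Rate

/-! ### The conserved quantity in the limit -/

namespace IsSupercritical

variable {p : ℕ → ℝ} (hp : IsSupercritical p)
include hp

lemma integrableOn_excess_Icc {y z : ℝ} (hy : extinctionRoot p < y) (hz : z < 1) :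
    IntegrableOn (excess p) (Set.Icc y z) :=
  (hp.continuousOn_excess.mono fun _ hx => ⟨hy.trans_le hx.1, hx.2.trans_lt hz⟩).integrableOn_Icc

lemma integrableOn_excess_Icc_one (hlog : Summable (fun k : ℕ => p k * k * Real.log k)) {y : ℝ}
    (hy : y ∈ Set.Ioo (extinctionRoot p) 1) : IntegrableOn (excess p) (Set.Icc y 1) :=
  integrableOn_Icc_iff_integrableOn_Ioo (by simp) (by simp) |>.2 ((hp.integrableOn_excess_iff hy).2 hlog)

/-- If `log (1 - u) - c - ∫ excess` and `log (1 - z) - ∫ excess` agree along sequences `u → η`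
and `z → 1` and the function `excess` is integrable near `1`, then `η` solves an equation. -/
lemma one_sub_eq_of_tendsto (hlog : Summable (fun k : ℕ => p k * k * Real.log k))
    {u z c : ℕ → ℝ} {η ρ : ℝ} (hη : extinctionRoot p < η) (hη1 : η ≤ 1)
    (hu : Tendsto u atTop (𝓝 η)) (hz : Tendsto z atTop (𝓝 1))
    (hc : Tendsto (fun n => (1 - z n) * Real.exp (c n)) atTop (𝓝 ρ))
    (hu1 : ∀ᶠ n in atTop, u n < 1) (hz1 : ∀ n, z n < 1)
    (hrel : ∀ y ∈ Set.Ioo (extinctionRoot p) 1, ∀ᶠ n in atTop,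
      Real.log (1 - u n) - c n - ∫ s in y..u n, excess p s
        = Real.log (1 - z n) - ∫ s in y..z n, excess p s) :
    1 - η = ρ * Real.exp (-∫ s in η..1, excess p s) := by
  obtain ⟨y, hqy, hyη⟩ := exists_between hη
  have hy : y ∈ Set.Ioo (extinctionRoot p) 1 := ⟨hqy, hyη.trans_le hη1⟩
  have hint := hp.integrableOn_excess_Icc_one hlog hy
  have hcont : ContinuousOn (fun x => ∫ s in y..x, excess p s) (Set.Icc y 1) := by
    have := intervalIntegral.continuousOn_primitive_interval (a := y) (b := 1)
      (by rwa [Set.uIcc_of_le hy.2.le] : IntegrableOn (excess p) (Set.uIcc y 1))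
    rwa [Set.uIcc_of_le hy.2.le] at this
  have hCu : Tendsto (fun n => ∫ s in y..u n, excess p s) atTop (𝓝 (∫ s in y..η, excess p s)) := by
    refine (hcont η ⟨hyη.le, hη1⟩).tendsto.comp (tendsto_nhdsWithin_iff.2 ⟨hu, ?_⟩)
    filter_upwards [hu.eventually (lt_mem_nhds hyη), hu1] with n h1 h2
    exact ⟨h1.le, h2.le⟩
  have hCz : Tendsto (fun n => ∫ s in y..z n, excess p s) atTop (𝓝 (∫ s in y..1, excess p s)) := by
    refine (hcont 1 ⟨hy.2.le, le_rfl⟩).tendsto.comp (tendsto_nhdsWithin_iff.2 ⟨hz, ?_⟩)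
    filter_upwards [hz.eventually (lt_mem_nhds hy.2)] with n h1
    exact ⟨h1.le, (hz1 n).le⟩
  have hlim : Tendsto (fun n => (1 - z n) * Real.exp (c n) *
      Real.exp ((∫ s in y..u n, excess p s) - ∫ s in y..z n, excess p s)) atTop
      (𝓝 (ρ * Real.exp ((∫ s in y..η, excess p s) - ∫ s in y..1, excess p s))) :=
    hc.mul ((Real.continuous_exp.tendsto _).comp (hCu.sub hCz))
  have heq : ∀ᶠ n in atTop, (1 - z n) * Real.exp (c n) *
      Real.exp ((∫ s in y..u n, excess p s) - ∫ s in y..z n, excess p s) = 1 - u n := by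
    filter_upwards [hrel y hy, hu1] with n h1 h2
    rw [← Real.exp_log (show 0 < 1 - z n by linarith [hz1 n]),
      ← Real.exp_log (show 0 < 1 - u n by linarith), ← Real.exp_add, ← Real.exp_add]
    congr 1
    linarith
  have := tendsto_nhds_unique (hlim.congr' heq) (hu.const_sub 1)
  rw [← this]
  congr 2
  have h1 := intervalIntegral.integral_add_adjacent_intervals (a := y) (b := η) (c := 1)
    (f := excess p) (μ := volume)
    ((intervalIntegrable_iff_integrableOn_Icc_of_le hyη.le).2
      (hint.mono_set (Set.Icc_subset_Icc_right hη1)))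
    ((intervalIntegrable_iff_integrableOn_Icc_of_le hη1).2
      (hint.mono_set (Set.Icc_subset_Icc_left hyη.le)))
  linarith

/-- If `log (1 - u) - c - ∫ excess` and `log (1 - z) - ∫ excess` agree along sequences `u → η`
and `z → 1` with `η < 1`, then the function `excess` is integrable near `1`. -/
lemma summable_log_of_tendsto
    {u z c : ℕ → ℝ} {η ρ : ℝ} (hη1 : η < 1)
    (hu : Tendsto u atTop (𝓝 η)) (hz : Tendsto z atTop (𝓝 1))
    (hc : Tendsto (fun n => (1 - z n) * Real.exp (c n)) atTop (𝓝 ρ))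
    (huq : ∀ᶠ n in atTop, extinctionRoot p < u n) (hz1 : ∀ n, z n < 1)
    (hrel : ∀ y ∈ Set.Ioo (extinctionRoot p) 1, ∀ᶠ n in atTop,
      Real.log (1 - u n) - c n - ∫ s in y..u n, excess p s
        = Real.log (1 - z n) - ∫ s in y..z n, excess p s) :
    Summable (fun k : ℕ => p k * k * Real.log k) := by
  -- With `y` above both `η` and `q`, eventually `u n < y`. Then `∫_y^{u n} excess ≤ 0` and `log (1
  -- - u n) ≥ log (1 - y)`, so the relation bounds `∫_y^{z n} excess`.
  obtain ⟨y, hqy, hy1⟩ := exists_between (max_lt hη1 hp.extinctionRoot_spec.1.2)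
  obtain ⟨hηy, hqy⟩ := max_lt_iff.1 hqy
  have hy : y ∈ Set.Ioo (extinctionRoot p) 1 := ⟨hqy, hy1⟩
  rw [← hp.integrableOn_excess_iff hy]
  refine IntegrableOn.mono_set ?_ Set.Ioo_subset_Ioc_self
  have hb : Tendsto (fun n => max y (z n)) atTop (𝓝 1) := by
    simpa [max_eq_right hy1.le] using (tendsto_const_nhds (x := y)).max hz
  refine integrableOn_Ioc_of_intervalIntegral_norm_bounded_right
    (I := Real.log (ρ + 1) - Real.log (1 - y)) (l := atTop) (fun n => ?_) hb ?_
  · exact (hp.integrableOn_excess_Icc hqy (max_lt hy1 (hz1 n))).mono_set Set.Ioc_subset_Icc_self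
  filter_upwards [hrel y hy, huq, hu.eventually (gt_mem_nhds hηy),
    hz.eventually (lt_mem_nhds hy1), hc.eventually (gt_mem_nhds (lt_add_one ρ))]
    with n h1 h2 h3 h4 h5
  have hzn : 0 < 1 - z n := by linarith [hz1 n]
  rw [max_eq_right h4.le]
  have h6 : ∫ x in Set.Ioc y (z n), ‖excess p x‖ = ∫ s in y..z n, excess p s := by
    rw [intervalIntegral.integral_of_le h4.le]
    refine setIntegral_congr_fun measurableSet_Ioc fun x hx => ?_
    exact Real.norm_of_nonneg (hp.excess_nonneg ⟨hqy.trans hx.1, hx.2.trans_lt (hz1 n)⟩)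
  have h7 : ∫ s in y..u n, excess p s ≤ 0 := by
    rw [intervalIntegral.integral_symm, neg_nonpos]
    exact intervalIntegral.integral_nonneg h3.le fun x hx =>
      hp.excess_nonneg ⟨h2.trans_le hx.1, hx.2.trans_lt hy1⟩
  have h8 : Real.log (1 - z n) + c n ≤ Real.log (ρ + 1) := by
    rw [← Real.log_exp (c n), ← Real.log_mul hzn.ne' (Real.exp_pos _).ne']
    exact Real.log_le_log (mul_pos hzn (Real.exp_pos _)) h5.le
  have h9 : Real.log (1 - y) ≤ Real.log (1 - u n) :=
    Real.log_le_log (by linarith) (by linarith)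
  rw [h6]
  linarith

lemma psi_integral (hlog : Summable (fun k : ℕ => p k * k * Real.log k)) {η : ℝ}
    (hη : η ∈ Set.Ioo (extinctionRoot p) 1) :
    IntervalIntegrable (psi p (extinctionRoot p) 1) volume η 1 ∧
      ∫ x in η..1, psi p (extinctionRoot p) 1 x
        = Real.log ((1 - extinctionRoot p) / (η - extinctionRoot p))
          - gam p (extinctionRoot p) 1 * ∫ x in η..1, excess p x := by
  set q := extinctionRoot p with hq
  have hexc : IntervalIntegrable (excess p) volume η 1 :=
    (intervalIntegrable_iff_integrableOn_Icc_of_le hη.2.le).2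
      (hp.integrableOn_excess_Icc_one hlog hη)
  have hinv : IntervalIntegrable (fun x => 1 / (x - q)) volume η 1 := by
    refine ContinuousOn.intervalIntegrable ?_
    refine continuousOn_const.div (by fun_prop) fun x hx => ?_
    rw [Set.uIcc_of_le hη.2.le] at hx
    linarith [hx.1, hη.1]
  have hae : (fun x => 1 / (x - q) - gam p q 1 * excess p x)
      =ᵐ[volume.restrict (Set.uIoc η 1)] psi p q 1 := by
    -- The identity `psi_eq` holds only for `x < 1`; the endpoint is a null set.
    rw [Set.uIoc_of_le hη.2.le, ← restrict_Ioo_eq_restrict_Ioc]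
    refine (ae_restrict_iff' measurableSet_Ioo).2 (Eventually.of_forall fun x hx => ?_)
    exact (hp.psi_eq ⟨hη.1.trans hx.1, hx.2⟩).symm
  refine ⟨(hinv.sub (hexc.const_mul _)).congr_ae hae, ?_⟩
  rw [← intervalIntegral.integral_congr_ae_restrict hae,
    intervalIntegral.integral_sub hinv (hexc.const_mul _), intervalIntegral.integral_const_mul,
    intervalIntegral.integral_comp_sub_right (fun x => 1 / x) q,
    integral_one_div_of_pos (by linarith [hη.1]) (by linarith [hη.1, hη.2])]

end IsSupercritical

namespace IsBranchingProcess

variable {Ω : Type*} [MeasurableSpace Ω] {μ : Measure Ω} [IsProbabilityMeasure μ] {p : ℕ → ℝ}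
  {Z : ℝ≥0 → Ω → ℕ} {P : ℝ≥0 → ℕ → ℕ → ℝ} {W : Ω → ℝ}

/-- The argument is chosen so that its `Z_n`-th power is `exp(-ρ Z_n e^{-(m₁ - 1) n})`, which is at
most `1` and converges almost surely to `e^{-ρ W}`. -/
lemma tendsto_genFun_laplace (hZ : IsBranchingProcess p Z μ)
    (hlaw : ∀ t j, μ.real {ω | Z t ω = j} = P t 1 j)
    (hW : ∀ᵐ ω ∂μ, Tendsto
        (fun t : ℝ≥0 => (Z t ω : ℝ) / Real.exp ((mean p - 1) * t)) atTop (𝓝 (W ω)))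
    {ρ : ℝ} (hρ : 0 ≤ ρ) :
    Tendsto (fun n : ℕ => genFun P n (Real.exp (-ρ * Real.exp (-((mean p - 1) * n)))))
      atTop (𝓝 (laplace μ W ρ)) := by
  set a := mean p - 1
  have hmem : ∀ n : ℕ, Real.exp (-ρ * Real.exp (-(a * n))) ∈ Set.Icc (0 : ℝ) 1 := fun n =>
    ⟨(Real.exp_pos _).le, Real.exp_le_one_iff.2 (by nlinarith [Real.exp_pos (-(a * n))])⟩
  have heq : ∀ n : ℕ, genFun P n (Real.exp (-ρ * Real.exp (-(a * n))))
      = ∫ ω, Real.exp (-ρ * ((Z n ω : ℝ) / Real.exp (a * (n : ℝ≥0)))) ∂μ := by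
    intro n
    rw [← integral_pow hZ hlaw n (hmem n)]
    refine integral_congr_ae (Eventually.of_forall fun ω => ?_)
    simp only [← Real.exp_nat_mul, div_eq_mul_inv, ← Real.exp_neg, NNReal.coe_natCast]
    congr 1; ring
  simp_rw [heq]
  refine tendsto_integral_of_dominated_convergence (fun _ => 1) (fun n => ?_)
    (integrable_const _) (fun n => Eventually.of_forall fun ω => ?_) ?_
  · exact ((measurable_of_countable fun k : ℕ =>
      Real.exp (-ρ * ((k : ℝ) / Real.exp (a * (n : ℝ≥0))))).comp (hZ.measurable n)).aestronglyMeasurable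
  · rw [Real.norm_of_nonneg (Real.exp_pos _).le, neg_mul]
    exact Real.exp_le_one_iff.2 (neg_nonpos.2 (by positivity))
  · filter_upwards [hW] with ω hω
    exact (Real.continuous_exp.tendsto _).comp
      ((hω.comp (tendsto_natCast_atTop_atTop (R := ℝ≥0))).const_mul (-ρ))

end IsBranchingProcess

end MarkovBranching

end

/-! ### Proof of the theorem -/

open MarkovBranching in
theorem mainTheorem7 {Ω : Type*} [MeasurableSpace Ω] (μ : Measure Ω) [IsProbabilityMeasure μ]
    (p : ℕ → ℝ) (hp0 : ∀ k, 0 ≤ p k) (hp1 : HasSum p 1)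
    (hm : Summable (fun k : ℕ => (k : ℝ) * p k)) (hm1 : 1 < MarkovBranching.mean p)
    (Z : ℝ≥0 → Ω → ℕ) (hZ : MarkovBranching.IsBranchingProcess p Z μ) :
    (∀ᵐ ω ∂μ, ∃ w : ℝ, Tendsto
      (fun t : ℝ≥0 => (Z t ω : ℝ) / Real.exp ((MarkovBranching.mean p - 1) * t)) atTop (𝓝 w)) ∧
    ∀ W : Ω → ℝ,
      (∀ᵐ ω ∂μ, Tendsto
        (fun t : ℝ≥0 => (Z t ω : ℝ) / Real.exp ((MarkovBranching.mean p - 1) * t))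
        atTop (𝓝 (W ω))) →
      (Summable (fun k : ℕ => p k * k * Real.log k) →
        ∀ ρ : ℝ, 0 < ρ →
          IntervalIntegrable (MarkovBranching.psi p (MarkovBranching.extinctionRoot p) 1) volume
            (MarkovBranching.laplace μ W ρ) 1 ∧
          MarkovBranching.laplace μ W ρ =
            MarkovBranching.extinctionRoot p + (1 - MarkovBranching.extinctionRoot p) *
              ((1 - MarkovBranching.laplace μ W ρ) / ρ) ^
                MarkovBranching.gam p (MarkovBranching.extinctionRoot p) 1 *
              Real.exp (-∫ x in (MarkovBranching.laplace μ W ρ)..1,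
                MarkovBranching.psi p (MarkovBranching.extinctionRoot p) 1 x) ∧
          MarkovBranching.laplace μ W ρ ∈ Set.Ioo (MarkovBranching.extinctionRoot p) 1) ∧
      (¬ Summable (fun k : ℕ => p k * k * Real.log k) →
        (∀ ρ : ℝ, 0 ≤ ρ → MarkovBranching.laplace μ W ρ = 1) ∧ ∀ᵐ ω ∂μ, W ω = 0) := by
  have hp : IsSupercritical p := ⟨hp0, hp1, hm, hm1⟩
  refine ⟨hZ.ae_exists_tendsto hp, fun W hW => ?_⟩
  obtain ⟨P, hP, hmarkov⟩ := hZ.markov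
  have ha : 0 < mean p - 1 := by linarith
  have hWm : AEMeasurable W μ := by
    refine aemeasurable_of_tendsto_metrizable_ae' (f := fun (n : ℕ) ω =>
      (Z n ω : ℝ) / Real.exp ((mean p - 1) * (n : ℝ≥0))) (fun n => ?_) ?_
    · exact ((measurable_of_countable fun k : ℕ =>
        (k : ℝ) / Real.exp ((mean p - 1) * (n : ℝ≥0))).comp (hZ.measurable n)).aemeasurable
    · filter_upwards [hW] with ω hω
      exact hω.comp (tendsto_natCast_atTop_atTop (R := ℝ≥0))
  have hW0 : ∀ᵐ ω ∂μ, 0 ≤ W ω := by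
    filter_upwards [hW] with ω hω
    exact ge_of_tendsto' hω fun t => by positivity
  have hu := fun {ρ : ℝ} (hρ : 0 ≤ ρ) =>
    hZ.tendsto_genFun_laplace (hZ.measureReal_eq hmarkov) hW hρ
  have hz : ∀ ρ : ℝ, Tendsto (fun n : ℕ => Real.exp (-ρ * Real.exp (-((mean p - 1) * n))))
      atTop (𝓝 1) := fun ρ => tendsto_exp_neg_mul_exp ha
  have hz1 : ∀ ρ : ℝ, 0 < ρ → ∀ n : ℕ, Real.exp (-ρ * Real.exp (-((mean p - 1) * n))) < 1 :=
    fun ρ hρ n => Real.exp_lt_one_iff.2 (by nlinarith [Real.exp_pos (-((mean p - 1) * n))])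
  have hzmem : ∀ ρ : ℝ, 0 < ρ → ∀ᶠ n : ℕ in atTop,
      Real.exp (-ρ * Real.exp (-((mean p - 1) * n))) ∈ Set.Ioo (extinctionRoot p) 1 :=
    fun ρ hρ => ((hz ρ).eventually (lt_mem_nhds hp.extinctionRoot_spec.1.2)).mono
      fun n hn => ⟨hn, hz1 ρ hρ n⟩
  have huq : ∀ ρ : ℝ, 0 < ρ → ∀ᶠ n : ℕ in atTop, extinctionRoot p
      < genFun P n (Real.exp (-ρ * Real.exp (-((mean p - 1) * n)))) :=
    fun ρ hρ => (hzmem ρ hρ).mono fun n hn => hP.extinctionRoot_lt_genFun hp hn n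
  have hu1 : ∀ ρ : ℝ, 0 < ρ → ∀ᶠ n : ℕ in atTop,
      genFun P n (Real.exp (-ρ * Real.exp (-((mean p - 1) * n)))) < 1 :=
    fun ρ hρ => Eventually.of_forall fun n =>
      hP.genFun_lt_one hp ⟨(Real.exp_pos _).le, hz1 ρ hρ n⟩ n
  have hrel : ∀ ρ : ℝ, 0 < ρ → ∀ y ∈ Set.Ioo (extinctionRoot p) 1, ∀ᶠ n : ℕ in atTop,
      Real.log (1 - genFun P n (Real.exp (-ρ * Real.exp (-((mean p - 1) * n)))))
        - (mean p - 1) * n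
        - ∫ s in y..genFun P n (Real.exp (-ρ * Real.exp (-((mean p - 1) * n)))), excess p s
      = Real.log (1 - Real.exp (-ρ * Real.exp (-((mean p - 1) * n))))
        - ∫ s in y..Real.exp (-ρ * Real.exp (-((mean p - 1) * n))), excess p s :=
    fun ρ hρ y hy => (hzmem ρ hρ).mono fun n hn => by
      simpa using hP.log_one_sub_genFun hp hn hy n
  have hle1 : ∀ ρ : ℝ, 0 < ρ → laplace μ W ρ ≤ 1 := fun ρ hρ => laplace_le_one hWm hW0 hρ.le
  refine ⟨fun hlog ρ hρ => ?_, fun hlog => ?_⟩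
  -- The limit only gives `η ≥ q`. If `η(ρ) ≤ q`, then `η(2ρ) ≥ q ≥ η(ρ)` forces `W = 0` almost
  -- surely, hence `η(ρ) = 1 > q`, a contradiction.
  · have hq : extinctionRoot p < laplace μ W ρ := by
      by_contra! hcon
      have h2 : extinctionRoot p ≤ laplace μ W (2 * ρ) :=
        ge_of_tendsto (hu (by positivity)) ((huq (2 * ρ) (by positivity)).mono fun n hn => hn.le)
      have h3 := ae_eq_zero_of_laplace_le hWm hW0 hρ.le (by linarith) (hcon.trans h2)
      rw [laplace_eq_one h3] at hcon
      linarith [hp.extinctionRoot_spec.1.2]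
    have heq := hp.one_sub_eq_of_tendsto hlog hq (hle1 ρ hρ) (hu hρ.le) (hz ρ)
      (tendsto_one_sub_mul_exp ha) (hu1 ρ hρ) (hz1 ρ hρ) (hrel ρ hρ)
    have hη : laplace μ W ρ ∈ Set.Ioo (extinctionRoot p) 1 := by
      refine ⟨hq, ?_⟩
      have := mul_pos hρ (Real.exp_pos (-∫ s in (laplace μ W ρ)..1, excess p s))
      linarith
    obtain ⟨hint, hval⟩ := hp.psi_integral hlog hη
    refine ⟨hint, ?_, hη⟩
    have hq1 : 0 < 1 - extinctionRoot p := by linarith [hη.1, hη.2]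
    have hηq : 0 < laplace μ W ρ - extinctionRoot p := by linarith [hη.1]
    have h1 : (1 - laplace μ W ρ) / ρ = Real.exp (-∫ s in (laplace μ W ρ)..1, excess p s) := by
      rw [div_eq_iff hρ.ne', mul_comm]
      exact heq
    -- The power `γ` of `(1 - η) / ρ` cancels the `γ ∫ excess` contained in `∫ ψ`; what remains is
    -- the logarithm of `(η - q) / (1 - q)`.
    have h2 : -(∫ s in (laplace μ W ρ)..1, excess p s) * gam p (extinctionRoot p) 1
        + -(Real.log ((1 - extinctionRoot p) / (laplace μ W ρ - extinctionRoot p))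
          - gam p (extinctionRoot p) 1 * ∫ s in (laplace μ W ρ)..1, excess p s)
        = Real.log ((laplace μ W ρ - extinctionRoot p) / (1 - extinctionRoot p)) := by
      rw [← inv_div (1 - extinctionRoot p), Real.log_inv]
      ring
    rw [hval, h1, ← Real.exp_mul, mul_assoc, ← Real.exp_add, h2,
      Real.exp_log (div_pos hηq hq1), mul_div_cancel₀ _ hq1.ne']
    ring
  · have hone : ∀ ρ : ℝ, 0 < ρ → laplace μ W ρ = 1 := by
      intro ρ hρ
      by_contra hne
      exact hlog (hp.summable_log_of_tendsto (lt_of_le_of_ne (hle1 ρ hρ) hne) (hu hρ.le) (hz ρ)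
        (tendsto_one_sub_mul_exp ha) (huq ρ hρ) (hz1 ρ hρ) (hrel ρ hρ))
    have hzero : ∀ᵐ ω ∂μ, W ω = 0 :=
      ae_eq_zero_of_laplace_le hWm hW0 zero_le_one one_lt_two
        (by rw [hone 1 one_pos, hone 2 two_pos])
    exact ⟨fun ρ _ => laplace_eq_one hzero ρ, hzero⟩
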